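/- For $c \in \mathbb{C}$ let $f_c(z) = z^2 + c$ and let $\lambda_c(z) = \lim_{n\to\infty} 2^{-n} \log^+ |f_c^n(z)|$ be its escape-rate function on $\mathbb{C}$, where $\log^+ = \max\{\log, 0\}$. Let $\mu_c = \frac{1}{2\pi} \Delta \lambda_c$ be the equilibrium measure of $f_c$, the Laplacian being taken in the sense of distributions. For $c_1, c_2 \in \mathbb{C}$ define the archimedean energy $E_\infty(c_1,c_2) = \int \lambda_{c_1} \, d\mu_{c_2}$. There exist constants $C, C' > 0$ such that for all $c_1, c_2 \in \mathbb{C}$ the function $\lambda_{c_1}$ is $\mu_{c_2}$-integrable and $$\frac{1}{16} \log^+ |c_1 - c_2| - C \;\leq\; E_\infty(c_1,c_2) \;\leq\; \frac12 \log^+ \max\{|c_1|, |c_2|\} + C'.$$ Furthermore, with $L = 1000$: for all $c_1, c_2 \in \mathbb{C}$, if $r := \max\{|c_1|, |c_2|\} \geq L$ and $|c_1 - c_2| \geq 3/r^{1/2}$, then $$E_\infty(c_1,c_2) \;\geq\; \frac{1}{64} \log r.$$ -/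

import Mathlib

open Filter Topology MeasureTheory
open scoped Real ContDiff

/-- The quadratic polynomial `f_c(z) = z² + c`. -/
def quadraticMap (c z : ℂ) : ℂ := z ^ 2 + c

/-- The escape rate `λ_c(z) = lim_{n → ∞} 2⁻ⁿ log⁺ |f_cⁿ(z)|`. The limit exists for every `c` and
`z`: see `tendsto_escapeRate`. -/
noncomputable def escapeRate (c z : ℂ) : ℝ :=
  limUnder atTop fun n : ℕ => 1 / 2 ^ n * Real.posLog ‖(quadraticMap c)^[n] z‖

namespace QuadraticEnergy

/-- A smooth approximation of `log⁺ |z|`. -/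
noncomputable def smoothLog (z : ℂ) : ℝ := 1 / 2 * Real.log (1 + Complex.normSq z)

/-- Smooth approximations of the escape rate. -/
noncomputable def approxRate (c : ℂ) (n : ℕ) (z : ℂ) : ℝ :=
  1 / 2 ^ n * smoothLog ((quadraticMap c)^[n] z)

noncomputable def growthConst (c : ℂ) : ℝ := 1 / 2 * Real.log (4 + 4 * ‖c‖ ^ 2)

lemma abs_smoothLog_quadraticMap_sub (c z : ℂ) :
    |smoothLog (quadraticMap c z) - 2 * smoothLog z| ≤ growthConst c := by
  have h1 : ‖quadraticMap c z‖ ≤ ‖z‖ ^ 2 + ‖c‖ := by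
    rw [← norm_pow]
    exact norm_add_le (z ^ 2) c
  have h2 : ‖z‖ ^ 2 ≤ ‖quadraticMap c z‖ + ‖c‖ := by
    have := norm_sub_le (z ^ 2 + c) c
    rwa [add_sub_cancel_right, norm_pow] at this
  have hw := norm_nonneg (quadraticMap c z)
  unfold smoothLog growthConst
  simp only [Complex.normSq_eq_norm_sq]
  generalize ‖quadraticMap c z‖ = w at *
  have hz := norm_nonneg z
  have hc := norm_nonneg c
  generalize ‖z‖ = x at *
  generalize ‖c‖ = k at *
  have e1 : Real.log (1 + w ^ 2) ≤ Real.log (4 + 4 * k ^ 2) + 2 * Real.log (1 + x ^ 2) := by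
    have : Real.log (1 + w ^ 2) ≤ Real.log ((4 + 4 * k ^ 2) * (1 + x ^ 2) ^ 2) := by
      apply Real.log_le_log (by positivity)
      have : w ^ 2 ≤ (x ^ 2 + k) ^ 2 := by gcongr
      nlinarith [sq_nonneg (x ^ 2 - k), sq_nonneg (k * x), sq_nonneg (k * x ^ 2), sq_nonneg x]
    rw [Real.log_mul (by positivity) (by positivity), Real.log_pow] at this
    exact_mod_cast this
  have e2 : 2 * Real.log (1 + x ^ 2) ≤ Real.log (4 + 4 * k ^ 2) + Real.log (1 + w ^ 2) := by
    have : Real.log ((1 + x ^ 2) ^ 2) ≤ Real.log ((4 + 4 * k ^ 2) * (1 + w ^ 2)) := by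
      apply Real.log_le_log (by positivity)
      have : (x ^ 2) ^ 2 ≤ (w + k) ^ 2 := by gcongr
      nlinarith [sq_nonneg (w - k), sq_nonneg (x ^ 2 - 1), sq_nonneg (k * w), sq_nonneg w]
    rw [Real.log_mul (by positivity) (by positivity), Real.log_pow] at this
    exact_mod_cast this
  rw [abs_le]
  constructor <;> linarith

lemma abs_posLog_sub_smoothLog (z : ℂ) :
    |Real.posLog ‖z‖ - smoothLog z| ≤ 1 / 2 * Real.log 2 := by
  rw [Real.posLog_eq_log_max_one (norm_nonneg z)]
  unfold smoothLog
  rw [Complex.normSq_eq_norm_sq]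
  have hz := norm_nonneg z
  generalize ‖z‖ = x at *
  have h1 : Real.log (1 + x ^ 2) ≤ Real.log (2 * (max 1 x) ^ 2) := by
    apply Real.log_le_log (by positivity)
    rcases le_total 1 x with h | h
    · rw [max_eq_right h]; nlinarith
    · rw [max_eq_left h]; nlinarith
  have h2 : Real.log ((max 1 x) ^ 2) ≤ Real.log (1 + x ^ 2) := by
    apply Real.log_le_log (by positivity)
    rcases le_total 1 x with h | h
    · rw [max_eq_right h]; nlinarith
    · rw [max_eq_left h]; nlinarith
  have h3 : (0 : ℝ) < max 1 x := lt_max_of_lt_left one_pos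
  rw [Real.log_mul (by norm_num) (by positivity)] at h1
  rw [Real.log_pow] at h1 h2
  push_cast at h1 h2
  have := Real.log_nonneg (show (1 : ℝ) ≤ 2 by norm_num)
  rw [abs_le]
  constructor <;> linarith

lemma dist_approxRate_succ (c z : ℂ) (n : ℕ) :
    dist (approxRate c n z) (approxRate c (n + 1) z) ≤ growthConst c / 2 / 2 ^ n := by
  have h := abs_smoothLog_quadraticMap_sub c ((quadraticMap c)^[n] z)
  rw [dist_comm, Real.dist_eq]
  unfold approxRate
  rw [Function.iterate_succ_apply']
  have : ∀ a b : ℝ, 1 / 2 ^ (n + 1) * a - 1 / 2 ^ n * b = (a - 2 * b) / 2 / 2 ^ n := by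
    intro a b
    rw [pow_succ]
    field_simp
  rw [this, abs_div, abs_div, abs_of_pos (show (0 : ℝ) < 2 by norm_num),
    abs_of_pos (show (0 : ℝ) < 2 ^ n by positivity)]
  gcongr

lemma exists_tendsto_approxRate (c z : ℂ) :
    ∃ l, Tendsto (fun n => approxRate c n z) atTop (𝓝 l) :=
  cauchySeq_tendsto_of_complete (cauchySeq_of_le_geometric_two (dist_approxRate_succ c z))

lemma tendsto_posLog_of_tendsto_approxRate {c z : ℂ} {l : ℝ}
    (h : Tendsto (fun n => approxRate c n z) atTop (𝓝 l)) :
    Tendsto (fun n : ℕ => 1 / 2 ^ n * Real.posLog ‖(quadraticMap c)^[n] z‖) atTop (𝓝 l) := by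
  have hz : Tendsto (fun n : ℕ => 1 / 2 ^ n * Real.posLog ‖(quadraticMap c)^[n] z‖
      - approxRate c n z) atTop (𝓝 0) := by
    have h0 : Tendsto (fun n : ℕ => (1 / 2 : ℝ) ^ n * (1 / 2 * Real.log 2)) atTop (𝓝 0) := by
      simpa using (tendsto_pow_atTop_nhds_zero_of_lt_one (r := (1 / 2 : ℝ)) (by norm_num)
        (by norm_num)).mul_const (1 / 2 * Real.log 2)
    refine squeeze_zero_norm (fun n => ?_) h0
    unfold approxRate
    rw [← mul_sub, norm_mul, Real.norm_eq_abs, Real.norm_eq_abs,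
      abs_of_pos (show (0 : ℝ) < 1 / 2 ^ n by positivity), div_pow, one_pow]
    gcongr
    exact abs_posLog_sub_smoothLog _
  simpa using hz.add h

end QuadraticEnergy

open QuadraticEnergy in
theorem tendsto_escapeRate (c z : ℂ) :
    Tendsto (fun n : ℕ => 1 / 2 ^ n * Real.posLog ‖(quadraticMap c)^[n] z‖) atTop
      (𝓝 (escapeRate c z)) :=
  tendsto_nhds_limUnder
    ((exists_tendsto_approxRate c z).imp fun _ h => tendsto_posLog_of_tendsto_approxRate h)

namespace QuadraticEnergy

lemma dist_approxRate_escapeRate (c z : ℂ) (n : ℕ) :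
    dist (approxRate c n z) (escapeRate c z) ≤ growthConst c / 2 ^ n := by
  obtain ⟨l, hl⟩ := exists_tendsto_approxRate c z
  have : escapeRate c z = l :=
    tendsto_nhds_unique (tendsto_escapeRate c z) (tendsto_posLog_of_tendsto_approxRate hl)
  rw [this]
  exact dist_le_of_le_geometric_two_of_tendsto (dist_approxRate_succ c z) hl n

lemma contDiff_quadraticMap_iterate (c : ℂ) (n : ℕ) :
    ContDiff ℂ ∞ (quadraticMap c)^[n] := by
  induction n with
  | zero => exact contDiff_id
  | succ n ih =>
    rw [Function.iterate_succ']
    have : ContDiff ℂ ∞ (quadraticMap c) := by unfold quadraticMap; fun_prop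
    exact this.comp ih

lemma contDiff_log_one_add_normSq {h : ℂ → ℂ} (hh : ContDiff ℂ ∞ h) :
    ContDiff ℝ ∞ fun z => Real.log (1 + Complex.normSq (h z)) := by
  have h' : ContDiff ℝ ∞ h := hh.restrict_scalars ℝ
  have : ContDiff ℝ ∞ fun z => 1 + Complex.normSq (h z) := by
    simp only [Complex.normSq_eq_norm_sq]
    exact contDiff_const.add (h'.norm_sq ℝ)
  exact this.log fun z => by have := Complex.normSq_nonneg (h z); positivity

lemma contDiff_approxRate (c : ℂ) (n : ℕ) : ContDiff ℝ ∞ (approxRate c n) := by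
  unfold approxRate smoothLog
  exact contDiff_const.mul (contDiff_const.mul
    (contDiff_log_one_add_normSq (contDiff_quadraticMap_iterate c n)))

lemma continuous_escapeRate (c : ℂ) : Continuous (escapeRate c) := by
  have hu : TendstoUniformly (approxRate c) (escapeRate c) atTop := by
    rw [Metric.tendstoUniformly_iff]
    intro ε hε
    have h0 : Tendsto (fun n : ℕ => growthConst c / 2 ^ n) atTop (𝓝 0) := by
      simpa [div_eq_mul_inv] using (tendsto_pow_atTop_nhds_zero_of_lt_one (r := (1 / 2 : ℝ))
        (by norm_num) (by norm_num)).const_mul (growthConst c)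
    filter_upwards [h0.eventually_lt_const hε] with n hn z
    rw [dist_comm]
    exact (dist_approxRate_escapeRate c z n).trans_lt hn
  exact hu.continuous (Frequently.of_forall fun n => (contDiff_approxRate c n).continuous)

end QuadraticEnergy

open Laplacian in
/-- `μ` is the measure `(1 / 2π) Δ u` on `ℂ`, the Laplacian being taken in the sense of
distributions. -/
structure IsDistribLaplacian (u : ℂ → ℝ) (μ : Measure ℂ) : Prop where
  isLocallyFinite : IsLocallyFiniteMeasure μ
  integral_eq : ∀ φ : ℂ → ℝ, ContDiff ℝ ∞ φ → HasCompactSupport φ →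
    ∫ z, φ z ∂μ = 1 / (2 * π) * ∫ z, u z * (Δ φ) z

namespace QuadraticEnergy

open Laplacian

lemma laplacian_eq_fderiv {g : ℂ → ℝ} (hg : ContDiff ℝ ∞ g) (z : ℂ) :
    (Δ g) z = fderiv ℝ (fun x => fderiv ℝ g x 1) z 1 +
      fderiv ℝ (fun x => fderiv ℝ g x Complex.I) z Complex.I := by
  have hd : DifferentiableAt ℝ (fderiv ℝ g) z :=
    (hg.fderiv_right (m := 1) (by norm_cast)).differentiable (by norm_num) z
  rw [InnerProductSpace.laplacian_eq_iteratedFDeriv_complexPlane]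
  simp only [iteratedFDeriv_two_apply]
  rw [fderiv_clm_apply hd (differentiableAt_const _), fderiv_clm_apply hd (differentiableAt_const _)]
  simp

lemma contDiff_fderiv_apply {g : ℂ → ℝ} (hg : ContDiff ℝ ∞ g) (v : ℂ) :
    ContDiff ℝ ∞ fun x => fderiv ℝ g x v :=
  (hg.fderiv_right (m := ∞) (by norm_cast)).clm_apply contDiff_const

lemma integral_mul_fderiv {f g : ℂ → ℝ} (hf : ContDiff ℝ ∞ f) (hg : ContDiff ℝ ∞ g)
    (h : HasCompactSupport f ∨ HasCompactSupport g) (v : ℂ) :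
    ∫ x, f x * fderiv ℝ g x v = - ∫ x, fderiv ℝ f x v * g x := by
  have hf' := (contDiff_fderiv_apply hf v).continuous
  have hg' := (contDiff_fderiv_apply hg v).continuous
  have key : ∀ a b : ℂ → ℝ, Continuous a → Continuous b →
      (HasCompactSupport a ∨ HasCompactSupport b) → Integrable fun x => a x * b x := by
    intro a b ha hb hab
    refine (ha.mul hb).integrable_of_hasCompactSupport ?_
    rcases hab with hab | hab
    · exact hab.mul_right
    · exact hab.mul_left
  refine integral_mul_fderiv_eq_neg_fderiv_mul_of_integrable (key _ _ hf' hg.continuous ?_)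
    (key _ _ hf.continuous hg' ?_) (key _ _ hf.continuous hg.continuous h)
    (fun x _ => hf.differentiable (by simp) x) (fun x _ => hg.differentiable (by simp) x)
  · exact h.imp (fun h => h.fderiv_apply (𝕜 := ℝ) v) id
  · exact h.imp id (fun h => h.fderiv_apply (𝕜 := ℝ) v)

lemma continuous_laplacian {φ : ℂ → ℝ} (hφ : ContDiff ℝ ∞ φ) : Continuous (Δ φ) := by
  rw [funext (laplacian_eq_fderiv hφ)]
  exact (contDiff_fderiv_apply (contDiff_fderiv_apply hφ _) _).continuous.add
    (contDiff_fderiv_apply (contDiff_fderiv_apply hφ _) _).continuous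

lemma hasCompactSupport_laplacian {φ : ℂ → ℝ} (hφ : ContDiff ℝ ∞ φ) (h : HasCompactSupport φ) :
    HasCompactSupport (Δ φ) := by
  rw [funext (laplacian_eq_fderiv hφ)]
  exact ((h.fderiv_apply (𝕜 := ℝ) _).fderiv_apply (𝕜 := ℝ) _).add
    ((h.fderiv_apply (𝕜 := ℝ) _).fderiv_apply (𝕜 := ℝ) _)

lemma integrable_mul_laplacian {u φ : ℂ → ℝ} (hu : Continuous u) (hφ : ContDiff ℝ ∞ φ)
    (h : HasCompactSupport φ) : Integrable fun z => u z * (Δ φ) z :=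
  (hu.mul (continuous_laplacian hφ)).integrable_of_hasCompactSupport
    (hasCompactSupport_laplacian hφ h).mul_left

lemma integral_mul_laplacian {g φ : ℂ → ℝ} (hg : ContDiff ℝ ∞ g) (hφ : ContDiff ℝ ∞ φ)
    (h : HasCompactSupport φ) : ∫ z, g z * (Δ φ) z = ∫ z, (Δ g) z * φ z := by
  have key : ∀ v : ℂ, ∫ z, g z * fderiv ℝ (fun x => fderiv ℝ φ x v) z v
      = ∫ z, fderiv ℝ (fun x => fderiv ℝ g x v) z v * φ z := by
    intro v
    rw [integral_mul_fderiv hg (contDiff_fderiv_apply hφ v) (.inr (h.fderiv_apply (𝕜 := ℝ) v)),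
      integral_mul_fderiv (contDiff_fderiv_apply hg v) hφ (.inr h), neg_neg]
  have i1 : ∀ v : ℂ, Integrable fun z => g z * fderiv ℝ (fun x => fderiv ℝ φ x v) z v := fun v =>
    (hg.continuous.mul
      (contDiff_fderiv_apply (contDiff_fderiv_apply hφ v) v).continuous).integrable_of_hasCompactSupport
      ((h.fderiv_apply (𝕜 := ℝ) v).fderiv_apply (𝕜 := ℝ) v).mul_left
  have i2 : ∀ v : ℂ, Integrable fun z => fderiv ℝ (fun x => fderiv ℝ g x v) z v * φ z := fun v =>
    ((contDiff_fderiv_apply (contDiff_fderiv_apply hg v) v).continuous.mul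
      hφ.continuous).integrable_of_hasCompactSupport h.mul_left
  simp only [laplacian_eq_fderiv hg, laplacian_eq_fderiv hφ, mul_add, add_mul]
  rw [integral_add (i1 _) (i1 _), integral_add (i2 _) (i2 _), key, key]

lemma fderiv_log_one_add_normSq {h : ℂ → ℂ} (hh : ContDiff ℂ ∞ h) (v z : ℂ) :
    fderiv ℝ (fun z => Real.log (1 + Complex.normSq (h z))) z v
      = 2 * ((starRingEnd ℂ) (h z) * (deriv h z * v)).re / (1 + Complex.normSq (h z)) := by
  have hd : HasFDerivAt h ((ContinuousLinearMap.toSpanSingleton ℂ (deriv h z)).restrictScalars ℝ) z :=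
    ((hh.differentiable (by simp) z).hasDerivAt.hasFDerivAt).restrictScalars ℝ
  have hq : (0 : ℝ) < 1 + Complex.normSq (h z) := by
    have := Complex.normSq_nonneg (h z); positivity
  have h1 := ((hd.norm_sq).const_add 1).log (by rw [← Complex.normSq_eq_norm_sq]; exact hq.ne')
  simp only [← Complex.normSq_eq_norm_sq] at h1
  rw [h1.fderiv]
  simp [div_eq_inv_mul]
  left
  ring

lemma laplacian_log_one_add_normSq_nonneg {h : ℂ → ℂ} (hh : ContDiff ℂ ∞ h) (z : ℂ) :
    0 ≤ (Δ fun z => Real.log (1 + Complex.normSq (h z))) z := by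
  have hq : ∀ z, (0 : ℝ) < 1 + Complex.normSq (h z) := fun z => by
    have := Complex.normSq_nonneg (h z); positivity
  have hh' : ContDiff ℂ ∞ (deriv h) := by
    exact ((contDiff_infty_iff_deriv (𝕜 := ℂ)).1 hh).2
  have second : ∀ v : ℂ, fderiv ℝ
      (fun x => fderiv ℝ (fun z => Real.log (1 + Complex.normSq (h z))) x v) z v =
      2 * (((starRingEnd ℂ) (deriv h z * v) * (deriv h z * v)).re +
        ((starRingEnd ℂ) (h z) * (deriv (deriv h) z * v * v)).re) / (1 + Complex.normSq (h z))
      - (2 * ((starRingEnd ℂ) (h z) * (deriv h z * v)).re) ^ 2 / (1 + Complex.normSq (h z)) ^ 2 := by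
    intro v
    simp only [fderiv_log_one_add_normSq hh]
    have line : HasDerivAt (fun t : ℝ => z + t * v) v 0 := by
      simpa using ((Complex.ofRealCLM.hasDerivAt (x := (0 : ℝ))).mul_const v).const_add z
    have hz : z = z + ((0 : ℝ) : ℂ) * v := by simp
    have along : ∀ k : ℂ → ℂ, ContDiff ℂ ∞ k →
        HasDerivAt (fun t : ℝ => k (z + t * v)) (deriv k z * v) 0 := by
      intro k hk
      have := (hk.differentiable (by simp) (z + ((0 : ℝ) : ℂ) * v)).hasDerivAt.comp (0 : ℝ) line
      rwa [← hz] at this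
    have h0 := along h hh
    have h1 := (along _ hh').mul_const v
    have hnum := Complex.reCLM.hasFDerivAt.comp_hasDerivAt (0 : ℝ) (h0.star.mul h1)
    have hden := (h0.norm_sq).const_add (1 : ℝ)
    have hquot := (hnum.const_mul 2).div hden (by
      rw [← Complex.normSq_eq_norm_sq]; exact (hq _).ne')
    have hG : Differentiable ℝ fun x => 2 * ((starRingEnd ℂ) (h x) * (deriv h x * v)).re /
        (1 + Complex.normSq (h x)) := by
      have := (contDiff_fderiv_apply (contDiff_log_one_add_normSq hh) v).differentiable (by simp)
      simpa only [fderiv_log_one_add_normSq hh] using this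
    have hG' := ((hG (z + ((0 : ℝ) : ℂ) * v)).hasFDerivAt).comp_hasDerivAt (0 : ℝ) line
    rw [← hz] at hG'
    simp only [← Complex.normSq_eq_norm_sq] at hquot
    rw [hG'.unique hquot]
    simp only [Complex.ofReal_zero, zero_mul, add_zero, Complex.reCLM_apply, Function.comp_apply]
    have := (hq z).ne'
    field_simp
    simp [Complex.inner, pow_two]
    ring
  rw [laplacian_eq_fderiv (contDiff_log_one_add_normSq hh), second, second]
  have h0 := hq z
  generalize h z = b at *
  generalize deriv h z = a at *
  generalize deriv (deriv h) z = d at *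
  have : (0 : ℝ) ≤ 4 * Complex.normSq a / (1 + Complex.normSq b) ^ 2 := by
    have := Complex.normSq_nonneg a
    positivity
  refine this.trans_eq ?_
  field_simp
  simp [Complex.normSq_apply]
  ring

lemma laplacian_approxRate_nonneg (c : ℂ) (n : ℕ) (z : ℂ) : 0 ≤ (Δ (approxRate c n)) z := by
  have hh := contDiff_quadraticMap_iterate c n
  have : approxRate c n = (1 / 2 ^ n * (1 / 2) : ℝ) •
      fun z => Real.log (1 + Complex.normSq ((quadraticMap c)^[n] z)) := by
    ext z
    simp [approxRate, smoothLog, mul_assoc]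
  rw [this, InnerProductSpace.laplacian_smul _
    ((contDiff_log_one_add_normSq hh).of_le (by norm_cast)).contDiffAt]
  exact mul_nonneg (by positivity) (laplacian_log_one_add_normSq_nonneg hh z)

/-- The escape rate is subharmonic in the sense of distributions. -/
lemma integral_escapeRate_mul_laplacian_nonneg (c : ℂ) {φ : ℂ → ℝ} (hφ : ContDiff ℝ ∞ φ)
    (h : HasCompactSupport φ) (h0 : ∀ z, 0 ≤ φ z) : 0 ≤ ∫ z, escapeRate c z * (Δ φ) z := by
  have hn : ∀ n, 0 ≤ ∫ z, approxRate c n z * (Δ φ) z := fun n => by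
    rw [integral_mul_laplacian (contDiff_approxRate c n) hφ h]
    exact integral_nonneg fun z => mul_nonneg (laplacian_approxRate_nonneg c n z) (h0 z)
  have hlim : Tendsto (fun n => ∫ z, approxRate c n z * (Δ φ) z) atTop
      (𝓝 (∫ z, escapeRate c z * (Δ φ) z)) := by
    have hΔ : Integrable fun z => ‖(Δ φ) z‖ :=
      ((continuous_laplacian hφ).integrable_of_hasCompactSupport
        (hasCompactSupport_laplacian hφ h)).norm
    have hz : Tendsto (fun n : ℕ => growthConst c / 2 ^ n * ∫ z, ‖(Δ φ) z‖) atTop (𝓝 0) := by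
      have : Tendsto (fun n : ℕ => growthConst c * (1 / 2 : ℝ) ^ n * ∫ z, ‖(Δ φ) z‖) atTop
          (𝓝 (growthConst c * 0 * ∫ z, ‖(Δ φ) z‖)) :=
        ((tendsto_pow_atTop_nhds_zero_of_lt_one (by norm_num) (by norm_num)).const_mul _).mul_const _
      simpa [div_eq_mul_inv] using this
    rw [tendsto_iff_norm_sub_tendsto_zero]
    refine squeeze_zero (fun _ => norm_nonneg _) (fun n => ?_) hz
    rw [← integral_sub (integrable_mul_laplacian (contDiff_approxRate c n).continuous hφ h)
      (integrable_mul_laplacian (continuous_escapeRate c) hφ h), ← integral_const_mul]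
    refine norm_integral_le_of_norm_le (hΔ.const_mul _) (Eventually.of_forall fun z => ?_)
    rw [← sub_mul, norm_mul]
    have := dist_approxRate_escapeRate c z n
    rw [dist_eq_norm] at this
    gcongr
  exact ge_of_tendsto' hlim hn

open scoped CompactlySupported

/-- A continuous function whose distributional Laplacian is nonnegative on nonnegative test
functions has a Radon measure as its distributional Laplacian. -/
lemma exists_isDistribLaplacian {u : ℂ → ℝ} (hu : Continuous u)
    (hpos : ∀ φ : ℂ → ℝ, ContDiff ℝ ∞ φ → HasCompactSupport φ → (∀ z, 0 ≤ φ z) →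
      0 ≤ ∫ z, u z * (Δ φ) z) : ∃ μ : Measure ℂ, IsDistribLaplacian u μ := by
  have le2 : ∀ {φ : ℂ → ℝ}, ContDiff ℝ ∞ φ → ContDiff ℝ 2 φ := fun h => h.of_le (by norm_cast)
  let p : Submodule ℝ C_c(ℂ, ℝ) :=
    { carrier := {φ | ContDiff ℝ ∞ (φ : ℂ → ℝ)}
      add_mem' := fun {a b} ha hb => by
        simp only [Set.mem_ofPred_eq, CompactlySupportedContinuousMap.coe_add] at *
        exact ContDiff.add ha hb
      zero_mem' := by
        simp only [Set.mem_ofPred_eq, CompactlySupportedContinuousMap.coe_zero]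
        exact contDiff_const
      smul_mem' := fun r a ha => by
        simp only [Set.mem_ofPred_eq, CompactlySupportedContinuousMap.coe_smul] at *
        exact contDiff_const.smul ha }
  have hp : ∀ φ : p, ContDiff ℝ ∞ (φ.1 : ℂ → ℝ) := fun φ => φ.2
  let T : p →ₗ[ℝ] ℝ :=
    { toFun := fun φ => 1 / (2 * π) * ∫ z, u z * (Δ (φ.1 : ℂ → ℝ)) z
      map_add' := fun a b => by
        have h : (Δ ((a + b).1 : ℂ → ℝ))
            = fun z => (Δ (a.1 : ℂ → ℝ)) z + (Δ (b.1 : ℂ → ℝ)) z := by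
          ext z
          exact (le2 (hp a)).contDiffAt.laplacian_add (le2 (hp b)).contDiffAt
        simp only [h, mul_add]
        rw [integral_add (integrable_mul_laplacian hu (hp a) a.1.hasCompactSupport)
          (integrable_mul_laplacian hu (hp b) b.1.hasCompactSupport), mul_add]
      map_smul' := fun r a => by
        have h : (Δ ((r • a).1 : ℂ → ℝ)) = fun z => r * (Δ (a.1 : ℂ → ℝ)) z := by
          ext z
          exact InnerProductSpace.laplacian_smul r (le2 (hp a)).contDiffAt
        simp only [h, mul_left_comm _ r, integral_const_mul]
        simp }
  let s : PointedCone ℝ C_c(ℂ, ℝ) :=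
    { carrier := {f | ∀ z, 0 ≤ f z}
      add_mem' := fun {a b} ha hb => by
        simp only [Set.mem_ofPred_eq] at *
        exact fun z => add_nonneg (ha z) (hb z)
      zero_mem' := by simp
      smul_mem' := fun r a ha => by
        simp only [Set.mem_ofPred_eq] at *
        exact fun z => mul_nonneg r.2 (ha z) }
  have hs : ∀ f, f ∈ s ↔ ∀ z, 0 ≤ f z := fun _ => Iff.rfl
  obtain ⟨g, hg, hg0⟩ := riesz_extension s ⟨p, T⟩ (by
      intro φ hφ
      exact mul_nonneg (by positivity) (hpos _ (hp φ) φ.1.hasCompactSupport hφ)) (by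
      intro f
      obtain ⟨M, hM⟩ := f.hasCompactSupport.exists_bound_of_continuous f.continuous
      obtain ⟨R, hR, hfR⟩ := f.hasCompactSupport.isBounded.subset_closedBall_lt 0 0
      let B : ContDiffBump (0 : ℂ) := ⟨R, R + 1, hR, by linarith⟩
      have hB : ContDiff ℝ ∞ fun z => M * B z := contDiff_const.mul B.contDiff
      refine ⟨⟨⟨⟨fun z => M * B z, hB.continuous⟩, B.hasCompactSupport.mul_left⟩, hB⟩,
        fun z => ?_⟩
      have hM0 : 0 ≤ M := (norm_nonneg _).trans (hM 0)
      change 0 ≤ M * B z + f z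
      by_cases hz : z ∈ tsupport f
      · rw [B.one_of_mem_closedBall (hfR hz), mul_one]
        have := (abs_le.1 (hM z)).1
        linarith
      · rw [image_eq_zero_of_notMem_tsupport hz, add_zero]
        exact mul_nonneg hM0 B.nonneg)
  let Λ : C_c(ℂ, ℝ) →ₚ[ℝ] ℝ := PositiveLinearMap.mk₀ g fun f hf => hg0 f fun z => hf z
  refine ⟨RealRMK.rieszMeasure Λ, inferInstance, fun φ hφ hc => ?_⟩
  have h := RealRMK.integral_rieszMeasure Λ ⟨⟨φ, hφ.continuous⟩, hc⟩
  refine h.trans ?_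
  exact hg ⟨⟨⟨φ, hφ.continuous⟩, hc⟩, hφ⟩

/-- A distributional Laplacian determines the measure. -/
lemma isDistribLaplacian_unique {u : ℂ → ℝ} {μ ν : Measure ℂ} (hμ : IsDistribLaplacian u μ)
    (hν : IsDistribLaplacian u ν) : μ = ν := by
  have := hμ.isLocallyFinite
  have := hν.isLocallyFinite
  refine Measure.ext_of_integral_eq_on_compactlySupported fun f => ?_
  have hK : IsCompact (tsupport f) := f.hasCompactSupport
  have close : ∀ (m : Measure ℂ) [IsLocallyFiniteMeasure m] (g : ℂ → ℝ) (ε : ℝ), Continuous g →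
      HasCompactSupport g → Function.support g ⊆ Function.support f →
      (∀ z, dist (g z) (f z) < ε) →
      |∫ z, f z ∂m - ∫ z, g z ∂m| ≤ ε * m.real (tsupport f) := by
    intro m _ g ε hg hgc hgs hd
    have hf : Integrable (fun z => f z) m :=
      f.continuous.integrable_of_hasCompactSupport f.hasCompactSupport
    have hgi : Integrable g m := hg.integrable_of_hasCompactSupport hgc
    rw [← integral_sub hf hgi, ← Real.norm_eq_abs,
      ← setIntegral_eq_integral_of_forall_compl_eq_zero (s := tsupport f)]
    · refine norm_setIntegral_le_of_norm_le_const (μ := m) (hK.measure_lt_top (μ := m)) fun z _ => ?_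
      rw [← dist_eq_norm, dist_comm]
      exact (hd z).le
    · intro z hz
      have h1 : f z = 0 := image_eq_zero_of_notMem_tsupport hz
      have h2 : g z = 0 := by
        by_contra h
        exact hgs h h1
      rw [h1, h2, sub_zero]
  have bound : ∀ ε > 0, |∫ z, f z ∂μ - ∫ z, f z ∂ν|
      ≤ ε * (μ.real (tsupport f) + ν.real (tsupport f)) := by
    intro ε hε
    obtain ⟨g, hg, hd, hgs⟩ := f.continuous.exists_contDiff_approx ⊤ (continuous_const (y := ε))
      fun _ => hε
    have hgc : HasCompactSupport g := HasCompactSupport.of_support_subset_isCompact hK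
      (hgs.trans (subset_tsupport _))
    have e1 := close μ g ε hg.continuous hgc hgs hd
    have e2 := close ν g ε hg.continuous hgc hgs hd
    rw [hμ.integral_eq g hg hgc] at e1
    rw [hν.integral_eq g hg hgc] at e2
    rw [abs_le] at *
    constructor <;> linarith [e1.1, e1.2, e2.1, e2.2]
  have hlim : Tendsto (fun ε : ℝ => ε * (μ.real (tsupport f) + ν.real (tsupport f)))
      (𝓝[>] 0) (𝓝 0) := by
    have : Tendsto (fun ε : ℝ => ε * (μ.real (tsupport f) + ν.real (tsupport f)))
        (𝓝 0) (𝓝 (0 * (μ.real (tsupport f) + ν.real (tsupport f)))) := tendsto_id.mul_const _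
    rw [zero_mul] at this
    exact this.mono_left nhdsWithin_le_nhds
  have := ge_of_tendsto hlim (eventually_mem_nhdsWithin.mono fun ε hε => bound ε hε)
  exact sub_eq_zero.1 (abs_eq_zero.1 (le_antisymm this (abs_nonneg _)))

end QuadraticEnergy

open QuadraticEnergy in
/-- For every `c` there is exactly one measure `(1 / 2π) Δ λ_c`. -/
theorem existsUnique_equilibriumMeasure (c : ℂ) :
    ∃! μ : Measure ℂ, IsDistribLaplacian (escapeRate c) μ := by
  obtain ⟨μ, hμ⟩ := exists_isDistribLaplacian (continuous_escapeRate c)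
    fun _ => integral_escapeRate_mul_laplacian_nonneg c
  exact ⟨μ, hμ, fun _ hν => isDistribLaplacian_unique hν hμ⟩

/-- The equilibrium measure `μ_c = (1 / 2π) Δ λ_c` of `f_c`. -/
noncomputable def equilibriumMeasure (c : ℂ) : Measure ℂ :=
  (existsUnique_equilibriumMeasure c).choose

/-- The Euclidean energy `E_∞(c₁, c₂) = ∫ λ_{c₁} dμ_{c₂}`. -/
noncomputable def archimedeanEnergy (c₁ c₂ : ℂ) : ℝ :=
  ∫ z, escapeRate c₁ z ∂equilibriumMeasure c₂

/-! Let `δ = c₁ - c₂` and `s = √r` with `r = max |c₁| |c₂|`. The measure `μ_c` is a probability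
measure, invariant under `f_c` and under `z ↦ -z`; invariance under `f_c` forces it onto any disc
whose exterior `f_c` pushes outwards. On that disc `λ_{c₁}` is bounded above by iteration, which is
the upper bound `archimedeanEnergy_le`.

For lower bounds, `λ_{c₁} ∘ f_{c₁} = 2 λ_{c₁}` and `f_{c₁} = f_{c₂} + δ`, so invariance turns the
energy into half the mean of `λ_{c₁}(y + δ)` under `μ_{c₂}` (`archimedeanEnergy_eq_translate`), and
by evenness into a quarter of the mean of `λ_{c₁}(y + δ) + λ_{c₁}(-y + δ)`. If `|δ| ≥ 3.1 s`, the
translate leaves the disc where `λ_{c₁}` may be small (`le_archimedeanEnergy_of_far`). If `3 / s ≤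
|δ| ≤ 3.1 s`, then for almost every `y` at least one of `±y + δ` escapes within two steps
(`two_mul_le_norm_or`): otherwise both images `f_{c₁}(±y + δ) = f_{c₂}(y) + δ + δ² ± 2yδ` lie near
square roots of `-c₁`. The same root is excluded because `yδ` is not small, opposite roots because
`f_{c₂}(y)` is not small. In the remaining cases `|δ|` is bounded and nonnegativity of the energy
suffices. -/

namespace QuadraticEnergy

open Laplacian

/-! ### Conformal change of variables for the Laplacian and for `w = z²` -/

/-- The Laplacian of `φ ∘ h` for an entire function `h`. -/
lemma laplacian_comp_entire {φ : ℂ → ℝ} (hφ : ContDiff ℝ ∞ φ) {h : ℂ → ℂ} (hh : ContDiff ℂ ∞ h)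
    (z : ℂ) : (Δ (φ ∘ h)) z = ‖deriv h z‖ ^ 2 * (Δ φ) (h z) := by
  have hh' : ContDiff ℂ ∞ (deriv h) := ((contDiff_infty_iff_deriv (𝕜 := ℂ)).1 hh).2
  have hd : ∀ k : ℂ → ℂ, ContDiff ℂ ∞ k → ∀ x, HasFDerivAt k
      ((ContinuousLinearMap.toSpanSingleton ℂ (deriv k x)).restrictScalars ℝ) x := fun k hk x =>
    ((hk.differentiable (by simp) x).hasDerivAt.hasFDerivAt).restrictScalars ℝ
  have hφd : Differentiable ℝ (fderiv ℝ φ) :=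
    (hφ.fderiv_right (m := 1) (by norm_cast)).differentiable (by norm_num)
  have first : ∀ v x, fderiv ℝ (φ ∘ h) x v = fderiv ℝ φ (h x) (deriv h x * v) := by
    intro v x
    rw [((hφ.differentiable (by simp) (h x)).hasFDerivAt.comp x (hd h hh x)).fderiv]
    simp [mul_comm]
  have second : ∀ v, fderiv ℝ (fun x => fderiv ℝ (φ ∘ h) x v) z v =
      fderiv ℝ (fderiv ℝ φ) (h z) (deriv h z * v) (deriv h z * v) +
        fderiv ℝ φ (h z) (deriv (deriv h) z * v * v) := by
    intro v
    simp only [first]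
    have h1 := ((hφd (h z)).hasFDerivAt.comp z (hd h hh z)).clm_apply
      ((hd _ hh' z).mul_const v)
    simp only [Function.comp_apply] at h1
    erw [h1.fderiv]
    simp [mul_comm, add_comm]
  have hcomp : ContDiff ℝ ∞ (φ ∘ h) := hφ.comp (hh.restrict_scalars ℝ)
  have d1 : ∀ w v, fderiv ℝ (fun x => fderiv ℝ φ x v) w v = fderiv ℝ (fderiv ℝ φ) w v v := by
    intro w v
    rw [fderiv_clm_apply (hφd w) (differentiableAt_const _)]
    simp
  rw [laplacian_eq_fderiv hcomp, laplacian_eq_fderiv hφ, second, second, d1, d1]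
  generalize fderiv ℝ (fderiv ℝ φ) (h z) = A
  generalize fderiv ℝ φ (h z) = B
  generalize deriv (deriv h) z = d
  -- The contributions of `h''` in the directions `1` and `i` cancel because `1² + i² = 0`.
  have e1 : d * Complex.I * Complex.I = -(d * 1 * 1) := by
    linear_combination d * Complex.I_mul_I
  rw [e1, map_neg]
  -- Multiplication by `h'` sends `1, i` to an orthogonal frame of length `|h'|`, so the trace of
  -- the Hessian is scaled by `|h'|²`.
  have e2 : deriv h z * 1 = (deriv h z).re • (1 : ℂ) + (deriv h z).im • Complex.I := by
    simp [Complex.re_add_im]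
  have e3 : deriv h z * Complex.I = (-(deriv h z).im) • (1 : ℂ) + (deriv h z).re • Complex.I := by
    apply Complex.ext <;> simp
  rw [e2, e3, ← Complex.normSq_eq_norm_sq, Complex.normSq_apply]
  simp only [map_add, map_smul, add_apply, smul_apply,
    smul_eq_mul]
  ring

lemma det_toSpanSingleton_restrictScalars (a : ℂ) :
    ((ContinuousLinearMap.toSpanSingleton ℂ a).restrictScalars ℝ).det = ‖a‖ ^ 2 := by
  rw [← Complex.normSq_eq_norm_sq, ← Algebra.norm_complex_apply, Algebra.norm_apply,
    ContinuousLinearMap.det]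
  congr 1
  ext
  simp [mul_comm]

lemma ae_ne_zero_of_linear {l : ℂ →ₗ[ℝ] ℝ} (hl : l ≠ 0) : ∀ᵐ z : ℂ, l z ≠ 0 := by
  have := Measure.addHaar_submodule (volume : Measure ℂ) (LinearMap.ker l)
    (fun h => hl (LinearMap.ker_eq_top.1 h))
  exact measure_mono_null (fun z hz => by simpa using hz) this

lemma ae_re_ne_zero : ∀ᵐ z : ℂ, z.re ≠ 0 :=
  ae_ne_zero_of_linear (l := Complex.reLm) fun h => by simpa using congrArg (fun l => l 1) h

lemma ae_im_ne_zero : ∀ᵐ z : ℂ, z.im ≠ 0 :=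
  ae_ne_zero_of_linear (l := Complex.imLm) fun h => by simpa using congrArg (fun l => l Complex.I) h

/-- The change of variables `w = z ^ 2`. -/
lemma integral_comp_sq (F : ℂ → ℝ) (hF : Integrable fun z => ‖2 * z‖ ^ 2 * F (z ^ 2)) :
    ∫ z : ℂ, ‖2 * z‖ ^ 2 * F (z ^ 2) = 2 * ∫ w, F w := by
  have hderiv : ∀ (s : Set ℂ), ∀ z ∈ s, HasFDerivWithinAt (fun z : ℂ => z ^ 2)
      ((ContinuousLinearMap.toSpanSingleton ℂ (2 * z)).restrictScalars ℝ) s z := by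
    intro s z _
    have : HasDerivAt (fun z : ℂ => z ^ 2) (2 * z) z := by simpa using hasDerivAt_pow 2 z
    exact (this.hasFDerivAt.restrictScalars ℝ).hasFDerivWithinAt
  -- Squaring maps each open half-plane bijectively onto the slit plane; the imaginary axis and the
  -- cut are null, so each half contributes one copy of `∫ F`.
  let U : Set ℂ := {z | 0 < z.re}
  let V : Set ℂ := {z | z.re < 0}
  have hU : MeasurableSet U := measurableSet_lt measurable_const Complex.measurable_re
  have hV : MeasurableSet V := measurableSet_lt Complex.measurable_re measurable_const
  have hsq : ∀ z : ℂ, z.re ≠ 0 → z ^ 2 ∈ Complex.slitPlane := by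
    intro z hz
    rw [Complex.mem_slitPlane_iff]
    by_cases hi : z.im = 0
    · left
      simp only [pow_two, Complex.mul_re, hi]
      have := mul_self_pos.2 hz
      linarith
    · right
      simp only [pow_two, Complex.mul_im]
      intro h
      exact mul_ne_zero hz hi (by linarith)
  have hroot : ∀ w ∈ Complex.slitPlane, ∃ z : ℂ, 0 < z.re ∧ z ^ 2 = w := by
    intro w hw
    refine ⟨w ^ (2⁻¹ : ℂ), ?_, by simp⟩
    rw [Complex.cpow_inv_two_re]
    refine Real.sqrt_pos.2 (half_pos ?_)
    rcases Complex.mem_slitPlane_iff.1 hw with h | h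
    · have := norm_nonneg w
      linarith
    · have := (abs_lt.1 (Complex.abs_re_lt_norm.2 h)).1
      linarith
  have imU : (fun z : ℂ => z ^ 2) '' U = Complex.slitPlane := by
    refine Set.Subset.antisymm ?_ fun w hw => hroot w hw
    rintro _ ⟨z, hz, rfl⟩
    exact hsq z (ne_of_gt hz)
  have imV : (fun z : ℂ => z ^ 2) '' V = Complex.slitPlane := by
    refine Set.Subset.antisymm ?_ fun w hw => ?_
    · rintro _ ⟨z, hz, rfl⟩
      exact hsq z (ne_of_lt hz)
    · obtain ⟨z, hz, rfl⟩ := hroot w hw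
      exact ⟨-z, show (-z).re < 0 by simpa using hz, by simp⟩
  have injU : Set.InjOn (fun z : ℂ => z ^ 2) U := by
    intro a ha b hb hab
    refine (sq_eq_sq_iff_eq_or_eq_neg.1 hab).resolve_right fun h => ?_
    have h1 : 0 < a.re := ha
    have h2 : 0 < b.re := hb
    rw [h, Complex.neg_re] at h1
    linarith
  have injV : Set.InjOn (fun z : ℂ => z ^ 2) V := by
    intro a ha b hb hab
    refine (sq_eq_sq_iff_eq_or_eq_neg.1 hab).resolve_right fun h => ?_
    have h1 : a.re < 0 := ha
    have h2 : b.re < 0 := hb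
    rw [h, Complex.neg_re] at h1
    linarith
  have hslit : ∫ w in Complex.slitPlane, F w = ∫ w, F w := by
    have : (Complex.slitPlane : Set ℂ) =ᵐ[volume] Set.univ :=
      eventuallyEq_univ.2 (ae_im_ne_zero.mono fun z hz => Complex.mem_slitPlane_iff.2 (.inr hz))
    rw [setIntegral_congr_set this, setIntegral_univ]
  have cU := integral_image_eq_integral_abs_det_fderiv_smul volume hU (hderiv U) injU F
  have cV := integral_image_eq_integral_abs_det_fderiv_smul volume hV (hderiv V) injV F
  rw [imU, hslit] at cU
  rw [imV, hslit] at cV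
  simp only [det_toSpanSingleton_restrictScalars, abs_pow, abs_norm, smul_eq_mul] at cU cV
  have hUV : Disjoint U V := Set.disjoint_left.2 fun z (h1 : 0 < z.re) (h2 : z.re < 0) =>
    lt_asymm h1 h2
  have hae : (U ∪ V : Set ℂ) =ᵐ[volume] Set.univ :=
    eventuallyEq_univ.2 (ae_re_ne_zero.mono fun z hz => hz.lt_or_gt.symm)
  rw [← setIntegral_univ, ← setIntegral_congr_set hae, setIntegral_union hUV hV
    hF.integrableOn hF.integrableOn, ← cU, ← cV]
  ring

/-! ### Bounds and functional equation for the escape rate -/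

/-- While `|c| ≤ (1 - a)|w|²`, one has `|f_c(w)| ≥ a|w|²`, so `a|w|` is at least squared at each
step; `a|w| ≥ 1` keeps the orbit from shrinking, so the condition persists. -/
lemma log_le_escapeRate {c z : ℂ} {a : ℝ} (ha : 0 < a) (ha1 : a ≤ 1) (haz : 1 ≤ a * ‖z‖)
    (hc : ‖c‖ ≤ (1 - a) * ‖z‖ ^ 2) : Real.log (a * ‖z‖) ≤ escapeRate c z := by
  have hit : ∀ n : ℕ, ‖z‖ ≤ ‖(quadraticMap c)^[n] z‖ ∧
      (a * ‖z‖) ^ 2 ^ n ≤ a * ‖(quadraticMap c)^[n] z‖ := by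
    intro n
    induction n with
    | zero => simp
    | succ n ih =>
      obtain ⟨h1, h2⟩ := ih
      rw [Function.iterate_succ_apply']
      set w := (quadraticMap c)^[n] z
      have h3 : ‖w‖ ^ 2 - ‖c‖ ≤ ‖quadraticMap c w‖ := by
        have := norm_sub_norm_le (w ^ 2) (-c)
        rwa [sub_neg_eq_add, norm_neg, norm_pow] at this
      have h4 : ‖z‖ ^ 2 ≤ ‖w‖ ^ 2 := by gcongr
      have h5 : a * ‖w‖ ^ 2 ≤ ‖quadraticMap c w‖ := by nlinarith
      have h6 : 1 ≤ a * ‖w‖ := haz.trans (by gcongr)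
      constructor
      · have := mul_le_mul_of_nonneg_right h6 (norm_nonneg w)
        nlinarith
      · rw [pow_succ, pow_mul]
        calc ((a * ‖z‖) ^ 2 ^ n) ^ 2 ≤ (a * ‖w‖) ^ 2 := by gcongr
          _ = a * (a * ‖w‖ ^ 2) := by ring
          _ ≤ _ := by gcongr
  refine ge_of_tendsto' (tendsto_escapeRate c z) fun n => ?_
  obtain ⟨-, h⟩ := hit n
  have hpos : 0 < a * ‖z‖ := one_pos.trans_le haz
  have h1 : (a * ‖z‖) ^ 2 ^ n ≤ ‖(quadraticMap c)^[n] z‖ :=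
    h.trans (mul_le_of_le_one_left (norm_nonneg _) ha1)
  have h2 := (Real.log_le_log (by positivity) h1).trans (le_max_right 0 _)
  rw [Real.log_pow] at h2
  push_cast at h2
  change _ ≤ Real.posLog _ at h2
  rw [one_div, ← div_eq_inv_mul, le_div_iff₀ (by positivity), mul_comm]
  exact h2

/-- The majorant `S ↦ b S²` dominates every step of the orbit, and under it `b S` is exactly
squared. -/
lemma escapeRate_le_log {c z : ℂ} {b T : ℝ} (hb : 1 ≤ b) (hT : 1 ≤ T) (hz : ‖z‖ ≤ T)
    (hc : ‖c‖ ≤ (b - 1) * T ^ 2) : escapeRate c z ≤ Real.log (b * T) := by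
  have hbT : 1 ≤ b * T := by nlinarith
  have hit : ∀ n : ℕ, ∃ S, T ≤ S ∧ ‖(quadraticMap c)^[n] z‖ ≤ S ∧ b * S = (b * T) ^ 2 ^ n := by
    intro n
    induction n with
    | zero => exact ⟨T, le_rfl, by simpa using hz, by simp⟩
    | succ n ih =>
      obtain ⟨S, h1, h2, h3⟩ := ih
      refine ⟨b * S ^ 2, by nlinarith [mul_nonneg (sub_nonneg.2 hb) (sq_nonneg S)], ?_, ?_⟩
      · rw [Function.iterate_succ_apply']
        set w := (quadraticMap c)^[n] z
        have h4 : ‖quadraticMap c w‖ ≤ ‖w‖ ^ 2 + ‖c‖ := by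
          rw [← norm_pow]
          exact norm_add_le (w ^ 2) c
        have h5 : ‖w‖ ^ 2 ≤ S ^ 2 := by gcongr
        have h6 : T ^ 2 ≤ S ^ 2 := by gcongr
        nlinarith
      · rw [pow_succ 2 n, pow_mul, ← h3]
        ring
  refine le_of_tendsto' (tendsto_escapeRate c z) fun n => ?_
  obtain ⟨S, h1, h2, h3⟩ := hit n
  have hS : ‖(quadraticMap c)^[n] z‖ ≤ (b * T) ^ 2 ^ n := by
    rw [← h3]
    nlinarith
  have h4 : Real.posLog ‖(quadraticMap c)^[n] z‖ ≤ 2 ^ n * Real.log (b * T) := by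
    refine (Real.posLog_le_posLog (norm_nonneg _) hS).trans_eq ?_
    rw [Real.posLog_eq_log (by rw [abs_of_nonneg (by positivity)]; exact one_le_pow₀ hbT),
      Real.log_pow]
    push_cast
    rfl
  rw [one_div, ← div_eq_inv_mul, div_le_iff₀ (by positivity), mul_comm]
  exact h4

lemma escapeRate_nonneg (c z : ℂ) : 0 ≤ escapeRate c z :=
  ge_of_tendsto' (tendsto_escapeRate c z) fun n => mul_nonneg (by positivity) Real.posLog_nonneg

lemma escapeRate_quadraticMap (c z : ℂ) :
    escapeRate c (quadraticMap c z) = 2 * escapeRate c z := by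
  refine tendsto_nhds_unique (tendsto_escapeRate c (quadraticMap c z)) ?_
  refine ((tendsto_escapeRate c z).comp (tendsto_add_atTop_nat 1)).const_mul 2 |>.congr fun n => ?_
  simp only [Function.comp_apply, Function.iterate_succ_apply]
  rw [pow_succ]
  field_simp

lemma escapeRate_neg (c z : ℂ) : escapeRate c (-z) = escapeRate c z := by
  have h := escapeRate_quadraticMap c (-z)
  have h' := escapeRate_quadraticMap c z
  have : quadraticMap c (-z) = quadraticMap c z := by simp [quadraticMap]
  rw [this] at h
  linarith

lemma exists_abs_escapeRate_sub_smoothLog_le (c : ℂ) {ε : ℝ} (hε : 0 < ε) :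
    ∃ R : ℝ, ∀ z : ℂ, R ≤ ‖z‖ → |escapeRate c z - smoothLog z| ≤ 2 * ε := by
  -- With `a = exp (-ε)` and `b = exp ε`, the two orbit bounds become `log |z| - ε` and `log |z| +
  -- ε` once `|z|` is large.
  have ha : Real.exp (-ε) < 1 := Real.exp_zero ▸ Real.exp_lt_exp.2 (by linarith)
  have hb : 1 < Real.exp ε := Real.one_lt_exp_iff.2 hε
  have hev : ∀ k : ℝ, 0 < k → ∀ M : ℝ, ∀ᶠ x : ℝ in atTop, M ≤ k * x ^ 2 := fun k hk M =>
    ((tendsto_pow_atTop (by norm_num)).const_mul_atTop hk).eventually_ge_atTop M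
  obtain ⟨R, hR⟩ := eventually_atTop.1 (((hev _ (sub_pos.2 ha) ‖c‖).and
    (hev _ (sub_pos.2 hb) ‖c‖)).and (((tendsto_id.const_mul_atTop
      (Real.exp_pos (-ε))).eventually_ge_atTop 1).and ((hev _ (sub_pos.2 hb) 1).and
      (eventually_ge_atTop 1))))
  refine ⟨R, fun z hz => ?_⟩
  obtain ⟨⟨h1, h2⟩, h3, h4, h5⟩ := hR _ hz
  have hpos : 0 < ‖z‖ := by linarith
  have l1 := log_le_escapeRate (Real.exp_pos _) ha.le h3 h1
  have l2 := escapeRate_le_log hb.le h5 le_rfl h2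
  rw [Real.log_mul (Real.exp_pos _).ne' hpos.ne', Real.log_exp] at l1 l2
  have s1 : Real.log ‖z‖ ≤ smoothLog z := by
    rw [smoothLog, Complex.normSq_eq_norm_sq]
    have := Real.log_le_log (by positivity) (show ‖z‖ ^ 2 ≤ 1 + ‖z‖ ^ 2 by linarith)
    rw [Real.log_pow] at this
    push_cast at this
    linarith
  have s2 : smoothLog z ≤ Real.log ‖z‖ + ε := by
    rw [smoothLog, Complex.normSq_eq_norm_sq]
    have : Real.log (1 + ‖z‖ ^ 2) ≤ Real.log (Real.exp ε * ‖z‖ ^ 2) :=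
      Real.log_le_log (by positivity) (by linarith)
    rw [Real.log_mul (Real.exp_pos _).ne' (by positivity), Real.log_exp, Real.log_pow] at this
    push_cast at this
    linarith
  rw [abs_le]
  constructor <;> linarith

/-! ### The equilibrium measure has total mass one -/

lemma contDiff_smoothLog : ContDiff ℝ ∞ smoothLog := by
  unfold smoothLog
  exact contDiff_const.mul (contDiff_log_one_add_normSq contDiff_id)

lemma laplacian_smoothLog (z : ℂ) : (Δ smoothLog) z = 2 / (1 + ‖z‖ ^ 2) ^ 2 := by
  have first : ∀ v x, fderiv ℝ smoothLog x v = ((starRingEnd ℂ) x * v).re / (1 + ‖x‖ ^ 2) := by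
    intro v x
    have h := fderiv_log_one_add_normSq contDiff_id v x
    have hd := (contDiff_log_one_add_normSq contDiff_id).differentiable (by simp) x
    change fderiv ℝ (fun z => 1 / 2 * Real.log (1 + Complex.normSq (id z))) x v = _
    rw [fderiv_const_mul hd, smul_apply, h]
    simp [Complex.normSq_eq_norm_sq]
    ring
  have second : ∀ v, fderiv ℝ (fun x => fderiv ℝ smoothLog x v) z v =
      ‖v‖ ^ 2 / (1 + ‖z‖ ^ 2) - 2 * ((starRingEnd ℂ) z * v).re ^ 2 / (1 + ‖z‖ ^ 2) ^ 2 := by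
    intro v
    have hfun : (fun x => fderiv ℝ smoothLog x v) =
        fun x => inner ℝ x v * (1 + ‖x‖ ^ 2)⁻¹ := by
      ext x
      rw [first, Complex.inner, div_eq_mul_inv, mul_comm v]
    have hq : (1 + ‖z‖ ^ 2) ≠ 0 := by positivity
    have h1 : HasFDerivAt (fun x : ℂ => inner ℝ x v)
        ((innerSL ℝ).flip v) z := ((innerSL ℝ).flip v).hasFDerivAt
    have h2 := ((hasFDerivAt_id (𝕜 := ℝ) z).norm_sq).const_add 1
    have h3 := h1.mul ((hasDerivAt_inv hq).comp_hasFDerivAt z h2)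
    rw [hfun]
    erw [h3.fderiv]
    simp [Complex.inner]
    rw [show ((innerSL ℝ) v) v = ‖v‖ ^ 2 from real_inner_self_eq_norm_sq v]
    field_simp
    ring
  rw [laplacian_eq_fderiv contDiff_smoothLog, second, second]
  have hq : (1 + ‖z‖ ^ 2) ≠ 0 := by positivity
  have hn := Complex.normSq_eq_norm_sq z
  rw [Complex.normSq_apply] at hn
  simp only [mul_one, Complex.conj_re, Complex.norm_I, norm_one, Complex.mul_re, Complex.I_re,
    Complex.I_im, Complex.conj_im]
  field_simp
  linear_combination (-2) * hn

/-- A primitive of the radial density of `Δ smoothLog` in polar coordinates; it rises from `-1` at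
the origin to `0` at infinity, so the total integral is `2π`. -/
lemma hasDerivAt_neg_inv_one_add_sq (x : ℝ) :
    HasDerivAt (fun x : ℝ => -(1 + x ^ 2)⁻¹) (x * (2 / (1 + x ^ 2) ^ 2)) x := by
  have hq : (1 + x ^ 2) ≠ 0 := by positivity
  refine (((hasDerivAt_pow 2 x).const_add 1).inv hq).neg.congr_deriv ?_
  push_cast
  ring

lemma tendsto_neg_inv_one_add_sq :
    Tendsto (fun x : ℝ => -(1 + x ^ 2)⁻¹) atTop (𝓝 0) := by
  have : Tendsto (fun x : ℝ => 1 + x ^ 2) atTop atTop :=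
    tendsto_atTop_add_const_left _ _ (tendsto_pow_atTop (by norm_num))
  simpa using this.inv_tendsto_atTop.neg

lemma integrable_laplacian_smoothLog : Integrable (Δ smoothLog) := by
  rw [funext laplacian_smoothLog]
  refine (integrable_fun_norm_addHaar volume (f := fun x : ℝ => 2 / (1 + x ^ 2) ^ 2)).2 ?_
  simpa using integrableOn_Ioi_deriv_of_nonneg' (a := 0)
    (fun x _ => hasDerivAt_neg_inv_one_add_sq x)
    (fun x hx => mul_nonneg (le_of_lt hx) (by positivity)) tendsto_neg_inv_one_add_sq

lemma integral_laplacian_smoothLog : ∫ z, (Δ smoothLog) z = 2 * π := by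
  have h := integral_Ioi_of_hasDerivAt_of_nonneg' (a := 0)
    (fun x _ => hasDerivAt_neg_inv_one_add_sq x)
    (fun x hx => mul_nonneg (le_of_lt hx) (by positivity)) tendsto_neg_inv_one_add_sq
  simp only [laplacian_smoothLog]
  rw [integral_fun_norm_addHaar volume (fun x : ℝ => 2 / (1 + x ^ 2) ^ 2)]
  simp only [Complex.finrank_real_complex, Nat.add_one_sub_one, pow_one, smul_eq_mul, h]
  simp [Measure.real]

/-- A smooth cutoff which is `1` on the disc of radius `n + 1` and vanishes outside the disc of
radius `2 * (n + 1)`. -/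
noncomputable def cutoff (n : ℕ) (z : ℂ) : ℝ :=
  (⟨1, 2, one_pos, one_lt_two⟩ : ContDiffBump (0 : ℂ)) (((n + 1 : ℝ)⁻¹) • z)

lemma contDiff_cutoff (n : ℕ) : ContDiff ℝ ∞ (cutoff n) :=
  ContDiffBump.contDiff _ |>.comp (contDiff_const_smul _)

lemma cutoff_nonneg (n : ℕ) (z : ℂ) : 0 ≤ cutoff n z := ContDiffBump.nonneg _

lemma cutoff_le_one (n : ℕ) (z : ℂ) : cutoff n z ≤ 1 := ContDiffBump.le_one _

lemma cutoff_eq_one {n : ℕ} {z : ℂ} (hz : ‖z‖ ≤ n + 1) : cutoff n z = 1 := by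
  refine ContDiffBump.one_of_mem_closedBall _ ?_
  have : (0 : ℝ) < n + 1 := by positivity
  rw [mem_closedBall_zero_iff, norm_smul, norm_inv, Real.norm_of_nonneg this.le,
    inv_mul_le_iff₀ this]
  simpa using hz

lemma hasCompactSupport_cutoff (n : ℕ) : HasCompactSupport (cutoff n) :=
  (ContDiffBump.hasCompactSupport _).comp_homeomorph
    (Homeomorph.smulOfNeZero ((n + 1 : ℝ)⁻¹) (by positivity))

lemma laplacian_cutoff_eq_zero {n : ℕ} {z : ℂ} (hz : ‖z‖ < n + 1) : (Δ (cutoff n)) z = 0 := by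
  have : cutoff n =ᶠ[𝓝 z] fun _ => 1 := by
    filter_upwards [(isOpen_lt continuous_norm continuous_const).mem_nhds hz] with w hw
    exact cutoff_eq_one (le_of_lt hw)
  rw [(InnerProductSpace.laplacian_congr_nhds this).eq_of_nhds]
  exact congrFun InnerProductSpace.laplacian_const z

/-- In dimension two the factor `(n + 1)⁻²` from the Laplacian cancels the growth of area. This
uniform bound makes an error tending to `0` at infinity negligible. -/
lemma integral_abs_laplacian_cutoff (n : ℕ) :
    ∫ z, |(Δ (cutoff n)) z| = ∫ z, |(Δ (cutoff 0)) z| := by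
  set a : ℂ := (((n + 1 : ℝ)⁻¹ : ℝ) : ℂ)
  have hfun : cutoff n = cutoff 0 ∘ fun z => a * z := by
    ext z
    simp [cutoff, a]
  have ha : ∀ z, deriv (fun z => a * z) z = a := fun z => by simp
  have hpos : (0 : ℝ) < n + 1 := by positivity
  have hΔ : ∀ z, |(Δ (cutoff n)) z| = (n + 1 : ℝ)⁻¹ ^ 2 *
      |(Δ (cutoff 0)) ((n + 1 : ℝ)⁻¹ • z)| := by
    intro z
    have hmul : ContDiff ℂ ∞ fun z => a * z := contDiff_const.mul contDiff_id
    rw [hfun, laplacian_comp_entire (contDiff_cutoff 0) hmul, ha,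
      abs_mul, abs_of_nonneg (by positivity)]
    simp [a]
    left
    rw [← Nat.cast_add_one, Complex.norm_natCast]
    push_cast
    rfl
  simp only [hΔ]
  have hscale := Measure.integral_comp_inv_smul volume (fun z : ℂ => |(Δ (cutoff 0)) z|)
    (n + 1 : ℝ)
  rw [integral_const_mul, hscale,
    Complex.finrank_real_complex, smul_eq_mul, abs_of_nonneg (by positivity)]
  field_simp

/-- Replace `λ_c` by `smoothLog`, whose Laplacian is explicit. Their difference tends to `0` at
infinity, and only its values far out are seen by `Δ (cutoff n)`. -/
lemma tendsto_integral_cutoff (c : ℂ) : Tendsto (fun n => ∫ z, escapeRate c z * (Δ (cutoff n)) z)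
    atTop (𝓝 (2 * π)) := by
  have h1 : Tendsto (fun n => ∫ z, smoothLog z * (Δ (cutoff n)) z) atTop (𝓝 (2 * π)) := by
    simp only [integral_mul_laplacian contDiff_smoothLog (contDiff_cutoff _)
      (hasCompactSupport_cutoff _), ← integral_laplacian_smoothLog]
    refine tendsto_integral_of_dominated_convergence (fun z => |(Δ smoothLog) z|) (fun n => ?_)
      integrable_laplacian_smoothLog.abs (fun n => Eventually.of_forall fun z => ?_)
      (Eventually.of_forall fun z => ?_)
    · exact ((continuous_laplacian contDiff_smoothLog).mul
        (contDiff_cutoff n).continuous).aestronglyMeasurable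
    · rw [norm_mul, Real.norm_eq_abs, Real.norm_of_nonneg (cutoff_nonneg n z)]
      exact mul_le_of_le_one_right (abs_nonneg _) (cutoff_le_one n z)
    · refine tendsto_const_nhds.congr' ?_
      filter_upwards [eventually_ge_atTop ⌈‖z‖⌉₊] with n hn
      rw [cutoff_eq_one, mul_one]
      exact (Nat.le_ceil _).trans ((Nat.cast_le.2 hn).trans (by linarith))
  have h2 : Tendsto (fun n => ∫ z, (escapeRate c z - smoothLog z) * (Δ (cutoff n)) z) atTop
      (𝓝 0) := by
    have hi : ∀ n, Integrable fun z => |(Δ (cutoff n)) z| := fun n =>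
      ((continuous_laplacian (contDiff_cutoff n)).integrable_of_hasCompactSupport
        (hasCompactSupport_laplacian (contDiff_cutoff n) (hasCompactSupport_cutoff n))).abs
    have hI : 0 ≤ ∫ z, |(Δ (cutoff 0)) z| := integral_nonneg fun _ => abs_nonneg _
    rw [Metric.tendsto_atTop]
    intro ε hε
    set I := ∫ z, |(Δ (cutoff 0)) z|
    -- This choice makes the final bound `ε * I / (I + 1) < ε`, with no need for `I` to be nonzero.
    have hδ : 0 < ε / (2 * (I + 1)) := by positivity
    obtain ⟨R, hR⟩ := exists_abs_escapeRate_sub_smoothLog_le c hδ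
    refine ⟨⌈R⌉₊, fun n hn => ?_⟩
    rw [dist_zero_right]
    have : ‖∫ z, (escapeRate c z - smoothLog z) * (Δ (cutoff n)) z‖ ≤
        ∫ z, 2 * (ε / (2 * (I + 1))) * |(Δ (cutoff n)) z| := by
      refine norm_integral_le_of_norm_le ((hi n).const_mul _) (Eventually.of_forall fun z => ?_)
      rw [norm_mul, Real.norm_eq_abs, Real.norm_eq_abs]
      rcases lt_or_ge ‖z‖ (n + 1) with hz | hz
      · simp [laplacian_cutoff_eq_zero hz]
      · gcongr
        refine hR z (((Nat.le_ceil R).trans (Nat.cast_le.2 hn)).trans (by linarith))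
    refine this.trans_lt ?_
    rw [integral_const_mul, integral_abs_laplacian_cutoff]
    change 2 * (ε / (2 * (I + 1))) * I < ε
    rw [show 2 * (ε / (2 * (I + 1))) * I = ε * (I / (I + 1)) by field_simp]
    exact mul_lt_of_lt_one_right hε ((div_lt_one (by linarith)).2 (by linarith))
  refine (by simpa using h1.add h2 : Tendsto _ _ _).congr fun n => ?_
  have hadd := integral_add
    (integrable_mul_laplacian contDiff_smoothLog.continuous (contDiff_cutoff n)
      (hasCompactSupport_cutoff n))
    (integrable_mul_laplacian ((continuous_escapeRate c).sub contDiff_smoothLog.continuous)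
      (contDiff_cutoff n) (hasCompactSupport_cutoff n))
  simp only [Pi.sub_apply] at hadd
  rw [← hadd]
  congr 1 with z
  ring

lemma isDistribLaplacian_equilibriumMeasure (c : ℂ) :
    IsDistribLaplacian (escapeRate c) (equilibriumMeasure c) :=
  (existsUnique_equilibriumMeasure c).choose_spec.1

instance isProbabilityMeasure_equilibriumMeasure (c : ℂ) :
    IsProbabilityMeasure (equilibriumMeasure c) := by
  have hμ := isDistribLaplacian_equilibriumMeasure c
  have := hμ.isLocallyFinite
  set μ := equilibriumMeasure c
  have hlim : Tendsto (fun n => ENNReal.ofReal (∫ z, cutoff n z ∂μ)) atTop (𝓝 1) := by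
    rw [← ENNReal.ofReal_one]
    refine ENNReal.tendsto_ofReal ?_
    have := (tendsto_integral_cutoff c).const_mul (1 / (2 * π))
    rw [one_div_mul_cancel (by positivity)] at this
    exact this.congr fun n =>
      (hμ.integral_eq _ (contDiff_cutoff n) (hasCompactSupport_cutoff n)).symm
  have heq : ∀ n, ENNReal.ofReal (∫ z, cutoff n z ∂μ) = ∫⁻ z, ENNReal.ofReal (cutoff n z) ∂μ :=
    fun n => ofReal_integral_eq_lintegral_ofReal
      ((contDiff_cutoff n).continuous.integrable_of_hasCompactSupport (hasCompactSupport_cutoff n))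
      (Eventually.of_forall (cutoff_nonneg n))
  simp only [heq] at hlim
  -- The cutoffs lie between the indicators of the exhausting discs and the constant `1`, so the
  -- limit of their integrals is the total mass.
  refine ⟨le_antisymm ?_ ?_⟩
  · have hm : Tendsto (fun n : ℕ => μ (Metric.closedBall 0 (n : ℝ))) atTop (𝓝 (μ Set.univ)) := by
      rw [← Metric.iUnion_closedBall_nat (0 : ℂ)]
      exact tendsto_measure_iUnion_atTop fun m n h =>
        Metric.closedBall_subset_closedBall (Nat.cast_le.2 h)
    refine le_of_tendsto_of_tendsto' hm hlim fun n => ?_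
    rw [← lintegral_indicator_one Metric.isClosed_closedBall.measurableSet]
    refine lintegral_mono fun z => Set.indicator_le (g := fun z => ENNReal.ofReal (cutoff n z))
      (fun z hz => ?_) z
    rw [cutoff_eq_one, ENNReal.ofReal_one]
    · rfl
    · rw [mem_closedBall_zero_iff] at hz
      linarith
  · refine le_of_tendsto' hlim fun n => ?_
    rw [← lintegral_one]
    exact lintegral_mono fun z => ENNReal.ofReal_le_one.2 (cutoff_le_one n z)

/-! ### Invariance and support of the equilibrium measure -/

lemma contDiff_quadraticMap (c : ℂ) : ContDiff ℂ ∞ (quadraticMap c) := by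
  unfold quadraticMap
  fun_prop

lemma continuous_quadraticMap (c : ℂ) : Continuous (quadraticMap c) :=
  (contDiff_quadraticMap c).continuous

lemma sq_norm_le_norm_quadraticMap_add (c z : ℂ) : ‖z‖ ^ 2 ≤ ‖quadraticMap c z‖ + ‖c‖ := by
  have := norm_sub_le (z ^ 2 + c) c
  rwa [add_sub_cancel_right, norm_pow] at this

lemma hasCompactSupport_comp_quadraticMap {φ : ℂ → ℝ} (h : HasCompactSupport φ) (c : ℂ) :
    HasCompactSupport (φ ∘ quadraticMap c) := by
  obtain ⟨R, hR, hφR⟩ := h.isBounded.subset_closedBall_lt 0 0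
  refine HasCompactSupport.intro (isCompact_closedBall 0 (R + ‖c‖ + 1)) fun z hz => ?_
  refine image_eq_zero_of_notMem_tsupport (f := φ) fun hmem => hz ?_
  have h1 : ‖quadraticMap c z‖ ≤ R := by simpa using hφR hmem
  have h2 := sq_norm_le_norm_quadraticMap_add c z
  have := norm_nonneg c
  rw [mem_closedBall_zero_iff]
  nlinarith [norm_nonneg z]

/-- The factor `|f_c'|²` from the Laplacian is the Jacobian of `f_c`. The factor `2` from `f_c`
being two-to-one cancels against `λ_c = ½ λ_c ∘ f_c`. -/
lemma integral_escapeRate_mul_laplacian_comp_quadraticMap (c : ℂ) {φ : ℂ → ℝ}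
    (hφ : ContDiff ℝ ∞ φ) (h : HasCompactSupport φ) :
    ∫ z, escapeRate c z * (Δ (φ ∘ quadraticMap c)) z = ∫ z, escapeRate c z * (Δ φ) z := by
  set G : ℂ → ℝ := fun w => escapeRate c (w + c) * (Δ φ) (w + c)
  have hfun : ∀ z, escapeRate c z * (Δ (φ ∘ quadraticMap c)) z =
      1 / 2 * (‖2 * z‖ ^ 2 * G (z ^ 2)) := by
    intro z
    have hd : deriv (quadraticMap c) z = 2 * z := by
      unfold quadraticMap
      simp
    have := escapeRate_quadraticMap c z
    rw [laplacian_comp_entire hφ (contDiff_quadraticMap c), hd]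
    change _ = 1 / 2 * (‖2 * z‖ ^ 2 * (escapeRate c (quadraticMap c z) *
      (Δ φ) (quadraticMap c z)))
    rw [this]
    ring
  have hint : Integrable fun z => ‖2 * z‖ ^ 2 * G (z ^ 2) := by
    have := (integrable_mul_laplacian (continuous_escapeRate c)
      (hφ.comp ((contDiff_quadraticMap c).restrict_scalars ℝ))
      (hasCompactSupport_comp_quadraticMap h c)).const_mul 2
    refine this.congr (Eventually.of_forall fun z => ?_)
    simp only [hfun]
    ring
  simp only [hfun]
  have htrans : ∫ w, G w = ∫ w, escapeRate c w * (Δ φ) w :=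
    integral_add_right_eq_self (fun w => escapeRate c w * (Δ φ) w) c
  rw [integral_const_mul, integral_comp_sq G hint, htrans]
  ring

/-- The equilibrium measure is invariant under `f_c`. -/
lemma measurePreserving_quadraticMap (c : ℂ) :
    MeasurePreserving (quadraticMap c) (equilibriumMeasure c) (equilibriumMeasure c) := by
  have hμ := isDistribLaplacian_equilibriumMeasure c
  have hm := (continuous_quadraticMap c).measurable
  -- The push-forward has the same potential `λ_c`, so uniqueness of the distributional Laplacian
  -- identifies it with `μ_c`.
  refine ⟨hm, isDistribLaplacian_unique (u := escapeRate c) ⟨?_, fun φ hφ h => ?_⟩ hμ⟩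
  · have := Measure.isProbabilityMeasure_map (μ := equilibriumMeasure c) hm.aemeasurable
    infer_instance
  · rw [integral_map hm.aemeasurable hφ.continuous.aestronglyMeasurable,
      ← integral_escapeRate_mul_laplacian_comp_quadraticMap c hφ h]
    exact hμ.integral_eq _ (hφ.comp ((contDiff_quadraticMap c).restrict_scalars ℝ))
      (hasCompactSupport_comp_quadraticMap h c)

lemma measurePreserving_neg_equilibriumMeasure (c : ℂ) :
    MeasurePreserving (fun z => -z) (equilibriumMeasure c) (equilibriumMeasure c) := by
  have hμ := isDistribLaplacian_equilibriumMeasure c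
  have hm : Measurable fun z : ℂ => -z := measurable_neg
  refine ⟨hm, isDistribLaplacian_unique (u := escapeRate c) ⟨?_, fun φ hφ h => ?_⟩ hμ⟩
  · have := Measure.isProbabilityMeasure_map (μ := equilibriumMeasure c) hm.aemeasurable
    infer_instance
  · have hneg : ContDiff ℂ ∞ fun z : ℂ => -z := contDiff_neg
    rw [integral_map hm.aemeasurable hφ.continuous.aestronglyMeasurable]
    refine (hμ.integral_eq (φ ∘ fun z => -z) (hφ.comp contDiff_neg)
      (h.comp_homeomorph (Homeomorph.neg ℂ))).trans ?_
    have hint : ∫ z, escapeRate c (-z) * (Δ φ) (-z) = ∫ z, escapeRate c z * (Δ φ) z :=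
      integral_neg_eq_self (fun z => escapeRate c z * (Δ φ) z) volume
    rw [← hint]
    congr 2 with z
    rw [laplacian_comp_entire hφ hneg, escapeRate_neg]
    simp

/-- The equilibrium measure is carried by every closed disc whose exterior is moved outwards. -/
lemma ae_norm_le {c : ℂ} {ρ : ℝ} (hρ : 1 ≤ ρ) (h : ρ + ‖c‖ < ρ ^ 2) :
    ∀ᵐ z ∂equilibriumMeasure c, ‖z‖ ≤ ρ := by
  set μ := equilibriumMeasure c
  set η := ρ ^ 2 - ‖c‖ - ρ with hη
  have hη0 : 0 < η := by linarith
  have hopen : ∀ t : ℝ, MeasurableSet {z : ℂ | t < ‖z‖} := fun t =>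
    measurableSet_lt measurable_const measurable_norm
  -- Since `t² - t` increases for `t ≥ ρ ≥ 1`, the gain `η` computed at `ρ` works at every larger
  -- radius. Iterating, the mass outside `ρ` is at most the mass outside `ρ + n η`, which tends to
  -- `0`.
  have step : ∀ t, ρ ≤ t → μ {z | t < ‖z‖} ≤ μ {z | t + η < ‖z‖} := by
    intro t ht
    rw [← (measurePreserving_quadraticMap c).measure_preimage (hopen (t + η)).nullMeasurableSet]
    refine measure_mono fun z (hz : t < ‖z‖) => ?_
    change t + η < ‖quadraticMap c z‖
    have := sq_norm_le_norm_quadraticMap_add c z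
    nlinarith
  have bound : ∀ n : ℕ, μ {z | ρ < ‖z‖} ≤ μ {z | ρ + n * η < ‖z‖} := by
    intro n
    induction n with
    | zero => simp
    | succ n ih =>
      refine ih.trans ((step _ (by nlinarith [n.cast_nonneg (α := ℝ)])).trans_eq ?_)
      push_cast
      ring_nf
  have hlim : Tendsto (fun n : ℕ => μ {z | ρ + n * η < ‖z‖}) atTop (𝓝 0) := by
    have hempty : ⋂ n : ℕ, {z : ℂ | ρ + n * η < ‖z‖} = ∅ := by
      refine Set.eq_empty_of_forall_notMem fun z hz => ?_
      obtain ⟨n, hn⟩ := exists_nat_gt (‖z‖ / η)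
      have h1 : ρ + n * η < ‖z‖ := Set.mem_iInter.1 hz n
      rw [div_lt_iff₀ hη0] at hn
      linarith
    rw [← measure_empty (μ := μ), ← hempty]
    refine tendsto_measure_iInter_atTop (fun n => (hopen _).nullMeasurableSet) ?_
      ⟨0, measure_ne_top _ _⟩
    intro m n hmn z (hz : ρ + n * η < ‖z‖)
    have : (m : ℝ) * η ≤ n * η := by gcongr
    exact lt_of_le_of_lt (by linarith) hz
  have h0 := le_antisymm (ge_of_tendsto' hlim bound) zero_le
  rw [ae_iff]
  simpa using h0

lemma integrable_equilibriumMeasure (c : ℂ) {g : ℂ → ℝ} (hg : Continuous g) :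
    Integrable g (equilibriumMeasure c) := by
  have hc := norm_nonneg c
  obtain ⟨M, hM⟩ := (isCompact_closedBall (0 : ℂ) (2 + ‖c‖)).exists_bound_of_continuousOn
    hg.continuousOn
  refine Integrable.of_bound hg.aestronglyMeasurable M ?_
  filter_upwards [ae_norm_le (c := c) (ρ := 2 + ‖c‖) (by linarith) (by nlinarith)] with z hz
  exact hM z (mem_closedBall_zero_iff.2 hz)

/-! ### The energy as a mean of translated escape rates, and the upper bound -/

lemma archimedeanEnergy_nonneg (c₁ c₂ : ℂ) : 0 ≤ archimedeanEnergy c₁ c₂ :=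
  integral_nonneg fun z => escapeRate_nonneg c₁ z

/-- Write `λ_{c₁} = ½ λ_{c₁} ∘ f_{c₁}` and `f_{c₁} = f_{c₂} + (c₁ - c₂)`, then use invariance of
`μ_{c₂}` under `f_{c₂}`. -/
lemma archimedeanEnergy_eq_translate (c₁ c₂ : ℂ) :
    archimedeanEnergy c₁ c₂ =
      1 / 2 * ∫ y, escapeRate c₁ (y + (c₁ - c₂)) ∂equilibriumMeasure c₂ := by
  have hmp := measurePreserving_quadraticMap c₂
  have hcont : Continuous fun y => escapeRate c₁ (y + (c₁ - c₂)) :=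
    (continuous_escapeRate c₁).comp (continuous_add_const _)
  have h := integral_map (μ := equilibriumMeasure c₂) hmp.measurable.aemeasurable
    (f := fun y => escapeRate c₁ (y + (c₁ - c₂))) hcont.aestronglyMeasurable
  rw [hmp.map_eq] at h
  rw [h, ← integral_const_mul, archimedeanEnergy]
  congr 1 with z
  have : quadraticMap c₂ z + (c₁ - c₂) = quadraticMap c₁ z := by
    unfold quadraticMap
    ring
  rw [this, escapeRate_quadraticMap]
  ring

lemma archimedeanEnergy_eq_symm (c₁ c₂ : ℂ) :
    archimedeanEnergy c₁ c₂ = 1 / 4 * ∫ y, (escapeRate c₁ (y + (c₁ - c₂)) +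
      escapeRate c₁ (-y + (c₁ - c₂))) ∂equilibriumMeasure c₂ := by
  have hmp := measurePreserving_neg_equilibriumMeasure c₂
  have hcont : Continuous fun y => escapeRate c₁ (y + (c₁ - c₂)) :=
    (continuous_escapeRate c₁).comp (continuous_add_const _)
  have h := integral_map (μ := equilibriumMeasure c₂) hmp.measurable.aemeasurable
    (f := fun y => escapeRate c₁ (y + (c₁ - c₂))) hcont.aestronglyMeasurable
  rw [hmp.map_eq] at h
  have hadd := integral_add (integrable_equilibriumMeasure c₂ hcont)
    (integrable_equilibriumMeasure c₂ (hcont.comp continuous_neg))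
  simp only [Function.comp_apply, ← h] at hadd
  rw [hadd, archimedeanEnergy_eq_translate]
  ring

lemma archimedeanEnergy_le {c₁ c₂ : ℂ} {M : ℝ} (hM : 1 ≤ M) (h₁ : ‖c₁‖ ≤ M ^ 2)
    (h₂ : ‖c₂‖ ≤ M ^ 2) : archimedeanEnergy c₁ c₂ ≤ Real.log M + Real.log 4 := by
  have hae : ∀ᵐ z ∂equilibriumMeasure c₂, escapeRate c₁ z ≤ Real.log M + Real.log 4 := by
    filter_upwards [ae_norm_le (c := c₂) (ρ := 2 * M) (by linarith) (by nlinarith)] with z hz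
    have := escapeRate_le_log (c := c₁) (b := 2) (by norm_num) (by linarith) hz (by nlinarith)
    rwa [show 2 * (2 * M) = M * 4 by ring, Real.log_mul (by positivity) (by norm_num)] at this
  refine (integral_mono_ae (integrable_equilibriumMeasure c₂ (continuous_escapeRate c₁))
    (integrable_const (Real.log M + Real.log 4)) hae).trans ?_
  simp

/-! ### Escape of one of the two translates -/

lemma log_le_escapeRate_of_two_mul_le {c w : ℂ} {s : ℝ} (hs : 31 ≤ s) (hc : ‖c‖ ≤ s ^ 2)
    (hw : 2 * s ≤ ‖w‖) : Real.log s ≤ escapeRate c w := by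
  -- The value `3 / 4` is the largest `a` with `s² ≤ (1 - a)(2s)²`.
  refine (Real.log_le_log (by linarith) ?_).trans (log_le_escapeRate (a := 3 / 4) (by norm_num)
    (by norm_num) (by linarith) (by nlinarith))
  linarith

lemma half_log_le_escapeRate {c w : ℂ} {s : ℝ} (hs : 31 ≤ s) (hc : ‖c‖ ≤ s ^ 2)
    (hw : 2 * s ≤ ‖quadraticMap c w‖) : 1 / 2 * Real.log s ≤ escapeRate c w := by
  have := log_le_escapeRate_of_two_mul_le hs hc hw
  rw [escapeRate_quadraticMap] at this
  linarith

/-- If `f_c(p)` is small compared with a square root `q` of `-c`, then `p` is close to `q` or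
to `-q`. -/
lemma norm_sub_le_or_norm_add_le {c p q : ℂ} {s : ℝ} (hs : 31 ≤ s) (hq : q ^ 2 = -c)
    (hqs : 0.94 * s ≤ ‖q‖) (hp : ‖quadraticMap c p‖ < 2 * s) : ‖p - q‖ ≤ 2.2 ∨ ‖p + q‖ ≤ 2.2 := by
  have hfac : quadraticMap c p = (p - q) * (p + q) := by
    unfold quadraticMap
    linear_combination hq
  rw [hfac, norm_mul] at hp
  have h2q : 2 * ‖q‖ ≤ ‖p + q‖ + ‖p - q‖ := by
    have := norm_sub_le (p + q) (p - q)
    rwa [show p + q - (p - q) = 2 * q by ring, norm_mul, Complex.norm_two] at this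
  -- The larger of `|p - q|` and `|p + q|` is at least `|q| ≥ 0.94 s`, so the smaller is below `2 /
  -- 0.94 < 2.2`.
  by_contra! h
  rcases le_total ‖p - q‖ ‖p + q‖ with h' | h'
  · nlinarith
  · nlinarith

/-- When `f_c(z)` is only of order `s`, `z²` is close to `-c`, of order `s²`. This is what keeps `y`
and `f_{c₂}(y)` away from `0`. -/
lemma norm_bounds_of_quadraticMap {c z : ℂ} {s : ℝ} (hs : 31 ≤ s) (hc : 0.9 * s ^ 2 ≤ ‖c‖)
    (hz : ‖quadraticMap c z‖ ≤ 1.02 * s) : 0.93 * s ≤ ‖z‖ := by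
  have h1 : ‖c‖ ≤ ‖quadraticMap c z‖ + ‖z‖ ^ 2 := by
    have := norm_sub_le (z ^ 2 + c) (z ^ 2)
    rwa [add_sub_cancel_left, norm_pow] at this
  by_contra! h
  nlinarith [norm_nonneg z]

lemma two_mul_le_norm_or {c₁ c₂ y : ℂ} {s : ℝ} (hs : 31 ≤ s) (hmax : max ‖c₁‖ ‖c₂‖ = s ^ 2)
    (hδ : 3 ≤ s * ‖c₁ - c₂‖) (hδ' : ‖c₁ - c₂‖ ≤ 3.1 * s)
    (hy : ‖quadraticMap c₂ y‖ ≤ 1.02 * s)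
    (hy' : ‖quadraticMap c₂ (quadraticMap c₂ y)‖ ≤ 1.02 * s) :
    2 * s ≤ ‖quadraticMap c₁ (quadraticMap c₁ (y + (c₁ - c₂)))‖ ∨
      2 * s ≤ ‖quadraticMap c₁ (quadraticMap c₁ (-y + (c₁ - c₂)))‖ := by
  -- The larger parameter has modulus `s²`, and the other differs from it by at most `3.1 s ≤ 0.1
  -- s²`, as `s ≥ 31`.
  have hc₁ : 0.9 * s ^ 2 ≤ ‖c₁‖ := by
    rcases max_choice ‖c₁‖ ‖c₂‖ with h | h
    · rw [← h, hmax]; nlinarith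
    · have := norm_sub_norm_le c₂ c₁
      rw [norm_sub_rev] at this
      nlinarith
  have hc₂ : 0.9 * s ^ 2 ≤ ‖c₂‖ := by
    rcases max_choice ‖c₁‖ ‖c₂‖ with h | h
    · have := norm_sub_norm_le c₁ c₂
      nlinarith
    · rw [← h, hmax]; nlinarith
  have hc₁' : ‖c₁‖ ≤ s ^ 2 := hmax ▸ le_max_left _ _
  have ny := norm_bounds_of_quadraticMap hs hc₂ hy
  have nu := norm_bounds_of_quadraticMap hs hc₂ hy'
  obtain ⟨q, hq⟩ := IsAlgClosed.exists_pow_nat_eq (-c₁) (n := 2) (by norm_num)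
  have hqn : ‖q‖ ^ 2 = ‖c₁‖ := by rw [← norm_pow, hq, norm_neg]
  have hq1 : 0.94 * s ≤ ‖q‖ := by
    by_contra! h
    nlinarith [norm_nonneg q]
  have hq2 : ‖q‖ ≤ s := by
    by_contra! h
    nlinarith
  set δ := c₁ - c₂ with hδdef
  have hp₁ : quadraticMap c₁ (y + δ) = quadraticMap c₂ y + δ + δ ^ 2 + 2 * (y * δ) := by
    simp only [quadraticMap, hδdef]
    ring
  have hp₂ : quadraticMap c₁ (-y + δ) = quadraticMap c₂ y + δ + δ ^ 2 - 2 * (y * δ) := by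
    simp only [quadraticMap, hδdef]
    ring
  by_contra! hcon
  obtain ⟨k1, k2⟩ := hcon
  have n1 := norm_sub_le_or_norm_add_le hs hq hq1 k1
  have n2 := norm_sub_le_or_norm_add_le hs hq hq1 k2
  rw [hp₁] at n1
  rw [hp₂] at n2
  set u := quadraticMap c₂ y
  have hyδ : 2.79 ≤ ‖y‖ * ‖δ‖ := by nlinarith [norm_nonneg δ]
  have h4 : ∀ x : ℂ, ‖4 * x‖ = 4 * ‖x‖ := fun x => by rw [norm_mul]; simp
  -- Near the same root, the difference gives `4|yδ| ≤ 4.4`, against `|yδ| ≥ 0.93 * 3 = 2.79`.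
  have same : ∀ t : ℂ, ‖u + δ + δ ^ 2 + 2 * (y * δ) - t‖ ≤ 2.2 →
      ‖u + δ + δ ^ 2 - 2 * (y * δ) - t‖ ≤ 2.2 → False := by
    intro t h1 h2
    have := (norm_sub_le _ _).trans (add_le_add h1 h2)
    rw [show u + δ + δ ^ 2 + 2 * (y * δ) - t - (u + δ + δ ^ 2 - 2 * (y * δ) - t) = 4 * (y * δ) by
      ring, h4, norm_mul] at this
    linarith
  -- Near opposite roots, the sum gives `|u + δ + δ²| ≤ 2.2` and the difference gives `4|yδ| ≤ 2s +
  -- 4.4`, hence `|δ| ≤ 0.6`. Then `u` is bounded by a small constant, against `|u| ≥ 0.93 s`.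
  have opp : ∀ t : ℂ, ‖t‖ ≤ s → ‖u + δ + δ ^ 2 + 2 * (y * δ) - t‖ ≤ 2.2 →
      ‖u + δ + δ ^ 2 - 2 * (y * δ) + t‖ ≤ 2.2 → False := by
    intro t ht h1 h2
    have hsum := (norm_add_le _ _).trans (add_le_add h1 h2)
    rw [show u + δ + δ ^ 2 + 2 * (y * δ) - t + (u + δ + δ ^ 2 - 2 * (y * δ) + t) =
      2 * (u + (δ + δ ^ 2)) by ring, norm_mul, Complex.norm_two] at hsum
    have hdiff := (norm_sub_le _ _).trans (add_le_add h1 h2)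
    have htri := norm_add_le (u + δ + δ ^ 2 + 2 * (y * δ) - t -
      (u + δ + δ ^ 2 - 2 * (y * δ) + t)) (2 * t)
    rw [show u + δ + δ ^ 2 + 2 * (y * δ) - t - (u + δ + δ ^ 2 - 2 * (y * δ) + t) + 2 * t =
      4 * (y * δ) by ring, h4, norm_mul, norm_mul, Complex.norm_two] at htri
    have hδ6 : ‖δ‖ ≤ 0.6 := by
      by_contra! h
      nlinarith
    have hu := norm_sub_le (u + (δ + δ ^ 2)) (δ + δ ^ 2)
    rw [add_sub_cancel_right] at hu
    have hδ2 := norm_add_le δ (δ ^ 2)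
    rw [norm_pow] at hδ2
    nlinarith [norm_nonneg δ]
  rcases n1 with n1 | n1 <;> rcases n2 with n2 | n2
  · exact same q n1 n2
  · exact opp q hq2 n1 n2
  · exact opp (-q) (by rwa [norm_neg]) (by rwa [sub_neg_eq_add]) (by rwa [← sub_eq_add_neg])
  · exact same (-q) (by rwa [sub_neg_eq_add]) (by rwa [sub_neg_eq_add])

/-! ### Lower bounds for the energy in the two regimes -/

lemma ae_norm_le_mul {c : ℂ} {s : ℝ} (hs : 31 ≤ s) (hc : ‖c‖ ≤ s ^ 2) :
    ∀ᵐ z ∂equilibriumMeasure c, ‖z‖ ≤ 1.02 * s :=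
  ae_norm_le (by linarith) (by nlinarith)

lemma le_archimedeanEnergy_of_far {c₁ c₂ : ℂ} {s : ℝ} (hs : 31 ≤ s)
    (hmax : max ‖c₁‖ ‖c₂‖ = s ^ 2) (hδ : 3.1 * s ≤ ‖c₁ - c₂‖) :
    1 / 2 * Real.log s ≤ archimedeanEnergy c₁ c₂ := by
  rw [archimedeanEnergy_eq_translate]
  have hcont : Continuous fun y => escapeRate c₁ (y + (c₁ - c₂)) :=
    (continuous_escapeRate c₁).comp (continuous_add_const _)
  have hae : ∀ᵐ y ∂equilibriumMeasure c₂, Real.log s ≤ escapeRate c₁ (y + (c₁ - c₂)) := by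
    filter_upwards [ae_norm_le_mul hs (hmax ▸ le_max_right _ _)] with y hy
    refine log_le_escapeRate_of_two_mul_le hs (hmax ▸ le_max_left _ _) ?_
    -- The threshold `3.1` leaves `|y + δ| ≥ (3.1 - 1.02) s ≥ 2s`.
    have := norm_sub_le (y + (c₁ - c₂)) y
    rw [add_sub_cancel_left] at this
    linarith
  have := integral_mono_ae (integrable_const (Real.log s))
    (integrable_equilibriumMeasure c₂ hcont) hae
  simp only [integral_const, probReal_univ, one_smul] at this
  linarith

lemma le_archimedeanEnergy_of_near {c₁ c₂ : ℂ} {s : ℝ} (hs : 31 ≤ s)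
    (hmax : max ‖c₁‖ ‖c₂‖ = s ^ 2) (hδ : 3 ≤ s * ‖c₁ - c₂‖) (hδ' : ‖c₁ - c₂‖ ≤ 3.1 * s) :
    1 / 16 * Real.log s ≤ archimedeanEnergy c₁ c₂ := by
  rw [archimedeanEnergy_eq_symm]
  have hcont : Continuous fun y => escapeRate c₁ (y + (c₁ - c₂)) :=
    (continuous_escapeRate c₁).comp (continuous_add_const _)
  have hmp := measurePreserving_quadraticMap c₂
  have h0 := ae_norm_le_mul hs (hmax ▸ le_max_right ‖c₁‖ ‖c₂‖)
  -- Null sets pull back under `f_{c₂}`, so almost every `y` has its first two images in the disc as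
  -- well.
  have h1 := hmp.quasiMeasurePreserving.ae h0
  have hae : ∀ᵐ y ∂equilibriumMeasure c₂, 1 / 4 * Real.log s ≤
      escapeRate c₁ (y + (c₁ - c₂)) + escapeRate c₁ (-y + (c₁ - c₂)) := by
    filter_upwards [h1, hmp.quasiMeasurePreserving.ae h1] with y hy hy'
    have e1 := escapeRate_quadraticMap c₁ (y + (c₁ - c₂))
    have e2 := escapeRate_quadraticMap c₁ (-y + (c₁ - c₂))
    have p1 := escapeRate_nonneg c₁ (y + (c₁ - c₂))
    have p2 := escapeRate_nonneg c₁ (-y + (c₁ - c₂))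
    have hc₁ : ‖c₁‖ ≤ s ^ 2 := hmax ▸ le_max_left _ _
    rcases two_mul_le_norm_or hs hmax hδ hδ' hy hy' with h | h
    · have := half_log_le_escapeRate hs hc₁ h
      linarith
    · have := half_log_le_escapeRate hs hc₁ h
      linarith
  have := integral_mono_ae (integrable_const (1 / 4 * Real.log s))
    ((integrable_equilibriumMeasure c₂ hcont).add
      (integrable_equilibriumMeasure c₂ (hcont.comp continuous_neg))) hae
  simp only [integral_const, probReal_univ, one_smul, Pi.add_apply, Function.comp_apply] at this
  linarith

lemma le_sqrt_of_thousand_le {r : ℝ} (hr : 1000 ≤ r) : 31 ≤ √r :=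
  Real.le_sqrt_of_sq_le (by linarith)

lemma posLog_norm_sub_le (c₁ c₂ : ℂ) : 1 / 16 * Real.posLog ‖c₁ - c₂‖ - Real.log 2000 ≤
    archimedeanEnergy c₁ c₂ := by
  set r := max ‖c₁‖ ‖c₂‖ with hr
  have hE := archimedeanEnergy_nonneg c₁ c₂
  have hL : 0 < Real.log 2000 := Real.log_pos (by norm_num)
  have hδ : ‖c₁ - c₂‖ ≤ 2 * r := by
    have := norm_sub_le c₁ c₂
    have := le_max_left ‖c₁‖ ‖c₂‖
    have := le_max_right ‖c₁‖ ‖c₂‖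
    linarith
  have posLog_le : ∀ t : ℝ, 1 ≤ t → ‖c₁ - c₂‖ ≤ t → Real.posLog ‖c₁ - c₂‖ ≤ Real.log t := by
    intro t ht h
    rw [← Real.posLog_eq_log (ht.trans (le_abs_self t))]
    exact Real.posLog_le_posLog (norm_nonneg _) h
  rcases lt_or_ge r 1000 with h | h
  · have := posLog_le 2000 (by norm_num) (by linarith)
    linarith
  have hs := le_sqrt_of_thousand_le h
  have hsq : √r ^ 2 = r := Real.sq_sqrt (by linarith)
  have hls : 0 ≤ Real.log √r := Real.log_nonneg (by linarith)
  rcases le_total (3.1 * √r) ‖c₁ - c₂‖ with hd | hd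
  · have h1 := le_archimedeanEnergy_of_far hs hsq.symm hd
    -- Only `|δ| ≤ 2r` is needed; the constant `2000` is kept so that every case has the same
    -- additive error.
    have h2 := posLog_le (2000 * √r ^ 2) (by nlinarith) (by linarith)
    rw [Real.log_mul (by norm_num) (by positivity), Real.log_pow] at h2
    push_cast at h2
    linarith
  · have h2 := posLog_le (2000 * √r) (by linarith) (by linarith)
    rw [Real.log_mul (by norm_num) (by positivity)] at h2
    rcases le_total 3 (√r * ‖c₁ - c₂‖) with hd' | hd'
    · have h1 := le_archimedeanEnergy_of_near hs hsq.symm hd' hd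
      linarith
    · have h1 : ‖c₁ - c₂‖ ≤ 2000 := by
        nlinarith [norm_nonneg (c₁ - c₂)]
      have := posLog_le 2000 (by norm_num) h1
      linarith

end QuadraticEnergy

open QuadraticEnergy in
theorem mainTheorem7 :
    (∃ C C' : ℝ, 0 < C ∧ 0 < C' ∧ ∀ c₁ c₂ : ℂ,
      Integrable (escapeRate c₁) (equilibriumMeasure c₂) ∧
      1 / 16 * Real.posLog ‖c₁ - c₂‖ - C ≤ archimedeanEnergy c₁ c₂ ∧
      archimedeanEnergy c₁ c₂ ≤ 1 / 2 * Real.posLog (max ‖c₁‖ ‖c₂‖) + C') ∧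
    (∀ (c₁ c₂ : ℂ) (r : ℝ), r = max ‖c₁‖ ‖c₂‖ → 1000 ≤ r → 3 / √r ≤ ‖c₁ - c₂‖ →
      1 / 64 * Real.log r ≤ archimedeanEnergy c₁ c₂) := by
  constructor
  · refine ⟨Real.log 2000, Real.log 4, Real.log_pos (by norm_num), Real.log_pos (by norm_num),
      fun c₁ c₂ => ⟨integrable_equilibriumMeasure c₂ (continuous_escapeRate c₁),
        posLog_norm_sub_le c₁ c₂, ?_⟩⟩
    have hr : 0 ≤ max ‖c₁‖ ‖c₂‖ := (norm_nonneg c₁).trans (le_max_left _ _)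
    -- Truncating at `1` makes `log⁺ r = 2 log M` hold for small parameters too.
    set M := √(max 1 (max ‖c₁‖ ‖c₂‖))
    have hsq : M ^ 2 = max 1 (max ‖c₁‖ ‖c₂‖) := Real.sq_sqrt (zero_le_one.trans (le_max_left _ _))
    have hM : 1 ≤ M := Real.one_le_sqrt.2 (le_max_left _ _)
    have h1 : ‖c₁‖ ≤ M ^ 2 := hsq ▸ (le_max_left _ _).trans (le_max_right _ _)
    have h2 : ‖c₂‖ ≤ M ^ 2 := hsq ▸ (le_max_right _ _).trans (le_max_right _ _)
    have h3 : Real.posLog (max ‖c₁‖ ‖c₂‖) = 2 * Real.log M := by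
      rw [Real.posLog_eq_log_max_one hr, ← hsq, Real.log_pow]
      push_cast
      rfl
    have := archimedeanEnergy_le hM h1 h2
    rw [h3]
    linarith
  · intro c₁ c₂ r hr h hd
    have hs := le_sqrt_of_thousand_le h
    have hsq : √r ^ 2 = r := Real.sq_sqrt (by linarith)
    have hmax : max ‖c₁‖ ‖c₂‖ = √r ^ 2 := by rw [hsq, hr]
    have hls : 0 ≤ Real.log √r := Real.log_nonneg (by linarith)
    have hlog : Real.log r = 2 * Real.log √r := by
      nth_rw 1 [← hsq]
      rw [Real.log_pow]
      push_cast
      rfl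
    rw [hlog]
    -- In terms of `log r` the two regimes give `1 / 4` and `1 / 32`, both better than `1 / 64`.
    rcases le_total (3.1 * √r) ‖c₁ - c₂‖ with hf | hf
    · have := le_archimedeanEnergy_of_far hs hmax hf
      linarith
    · rw [div_le_iff₀' (by linarith)] at hd
      have := le_archimedeanEnergy_of_near hs hmax hd hf
      linarith
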